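/- Let $r\ge 0$ be a fixed integer. For each $N$ let $\{B_N^{s,t}:1\le s,t\le r\}$ be a family of real random $N\times N$ matrices with $(B_N^{s,t})^{T}=B_N^{t,s}$, and let $y_N^{(s)}=(y_{Nj}^{(s)})_{1\le j\le N}$, $1\le s\le r$, be real random $N$-vectors, defined on the same probability space (which may depend on $N$), such that the family $\{B_N^{s,t}\}_{s,t}$ is independent of the family $\{y_N^{(s)}\}_s$ and all the entries $y_{Nj}^{(s)}$, $1\le s\le r$, $1\le j\le N$, are jointly independent with $\mathbb E\,y_{Nj}^{(s)}=0$, $\mathbb E\,|y_{Nj}^{(s)}|^2=1$ and $\sup_{N,j,s}\mathbb E|y_{Nj}^{(s)}|^4=m_4<\infty$. Put $\kappa_4(y_{Ni}^{(s)})=\mathbb E|y_{Ni}^{(s)}|^4-3$, and assume that, as $N\to\infty$: (i) for every $\epsilon>0$ and every $1\le s\le r$, $\displaystyle \frac1N\sum_{j=1}^N\mathbb E\Big[\big||y_{Nj}^{(s)}|^2-1\big|^2\,\mathbf 1_{\{||y_{Nj}^{(s)}|^2-1|>\epsilon\sqrt N\}}\Big]\to 0$; (ii) there is a constant $a>0$,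 not depending on $N$, such that almost surely $\max_{1\le s,t\le r}\|B_N^{s,t}\|\le a$ (operator norm); (iii) for all $1\le s,t\le r$, $\frac1N\operatorname{Tr}\big((B_N^{s,t})^{T}B_N^{s,t}\big)$ converges in probability to a number $a_2(s,t)$; (iv) for all $1\le s\le r$, $\frac1N\sum_{i=1}^N (B_N^{s,s})_{ii}^2\,\kappa_4(y_{Ni}^{(s)})$ converges in probability to a number $a_1(s)$. Then $a_2(s,t)\ge 0$ for $s\ne t$, $a_1(s)+2a_2(s,s)\ge 0$ for all $s$, and the random $r\times r$ matrix $$G_N=\frac1{\sqrt N}\Big((y_N^{(s)})^{T}B_N^{s,t}y_N^{(t)}-\delta_{s,t}\operatorname{Tr}B_N^{s,t}\Big)_{1\le s,t\le r}$$ converges in distribution, as $N\to\infty$, to a random real symmetric $r\times r$ matrix $G$ whose entries $G_{s,t}$, $1\le s\le t\le r$, are independent, with $G_{s,t}\sim\mathcal N(0,a_2(s,t))$ for $s\ne t$ and $G_{s,s}\sim\mathcal N(0,a_1(s)+2a_2(s,s))$ (where $\mathcal N(0,0)$ is the point mass at $0$). -/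

import Mathlib

open MeasureTheory ProbabilityTheory Filter Topology

noncomputable section

/-- Convergence in probability to a real constant `c` of random variables `X N`, where `X N` lives
on its own probability space `(Ω N, P N)`. -/
def TendstoInProbConst {Ω : ℕ → Type*} [∀ N, MeasurableSpace (Ω N)] (P : ∀ N, Measure (Ω N))
    (X : ∀ N, Ω N → ℝ) (c : ℝ) : Prop :=
  ∀ ε : ℝ, 0 < ε → Tendsto (fun N => P N {ω | ε ≤ |X N ω - c|}) atTop (𝓝 0)

/-- The fourth cumulant `E|X|^4 - 3` of a real standardized random variable. -/
def kappa4 {Ω : Type*} [MeasurableSpace Ω] (P : Measure Ω) (X : Ω → ℝ) : ℝ :=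
  (∫ ω, |X ω| ^ 4 ∂P) - 3

/-- The Lindeberg quantity
`(1/N) ∑ⱼ E[ ||y_j|² - 1|² ; ||y_j|² - 1| > ε √N ]` of a random `N`-vector `y`. -/
def lindebergSum {Ω : Type*} [MeasurableSpace Ω] (P : Measure Ω) {N : ℕ} (y : Fin N → Ω → ℝ)
    (ε : ℝ) : ℝ :=
  (1 / (N : ℝ)) * ∑ j : Fin N,
    ∫ ω in {ω | ε * √(N : ℝ) < |(|y j ω| ^ 2 - 1)|}, |(|y j ω| ^ 2 - 1)| ^ 2 ∂P

/-- The `r × r` random matrix with `(s, t)` entry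
`N^{-1/2} ((y^{(s)})ᵀ B^{s,t} y^{(t)} - δ_{s,t} Tr B^{s,t})`. -/
def quadFormMatrix {Ω : Type*} {r N : ℕ} (y : Fin r → Fin N → Ω → ℝ)
    (B : Fin r → Fin r → Ω → Matrix (Fin N) (Fin N) ℝ) (ω : Ω) : Fin r → Fin r → ℝ :=
  fun s t => (1 / √(N : ℝ)) *
    ((fun i => y s i ω) ⬝ᵥ (B s t ω).mulVec (fun i => y t i ω)
      - if s = t then (B s t ω).trace else 0)

end

/-! By Lévy's continuity theorem it suffices to follow the characteristic function of each linear
combination of the entries of `quadFormMatrix`. Such a combination is a single centred quadratic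
form, divided by √N, in the rN independent variables. Its coefficient array is glued from the blocks
and has bounded operator norm (`sum_mul_quadFormMatrix`, `blockArray_bound`). The whole problem thus
becomes a scalar central limit theorem for one quadratic form Q.

For a fixed symmetric array put φ(t) = E exp(itQ/s), with s = √N. The aim is φ'(t) ≈ -t v φ(t),
where v is the variance of Q/s; integrating from φ(0) = 1 gives φ(1) ≈ exp(-v/2)
(`norm_sub_exp_neg_le_of_deriv`). Write Q = ∑ U_k by rows, and isolate the variable z_k: Q = q_k +
D_k, where q_k does not involve z_k. Given the other variables, U_k has mean zero and U_k D_k has a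
mean c_k. Expanding exp(iτD_k) to first order therefore replaces U_k by iτ c_k up to a Taylor
remainder (`norm_integral_leave_one_out_le`). The part z_k² - 1 of D_k has only two moments, and
this is where the Lindeberg condition enters. Finally ∑ c_k is the variance of Q plus a fluctuation
of order √N in L¹ (`integral_abs_lin_add_quad_le`), negligible against s² = N.

The resulting bound depends on the array only through its norm, so by independence and Fubini it
holds for random coefficients, with the mean of exp(-v/2) over the random v. Conditions (iii) and
(iv) say exactly that v converges in probability (`quadVar_blockArray`), and the limit is the
characteristic function of independent Gaussian entries. -/

/-! ### Calculus of expectations -/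

lemma integrable_pow_of_memLp_four {Ω : Type*} [MeasurableSpace Ω] {P : Measure Ω}
    [IsProbabilityMeasure P] {X : Ω → ℝ} (hX : MemLp X 4 P) {k : ℕ} (hk : k ≤ 4) :
    Integrable (fun ω => X ω ^ k) P := by
  have h : MemLp X (k : ENNReal) P := hX.mono_exponent (by exact_mod_cast hk)
  rw [← integrable_norm_iff (by have := hX.aestronglyMeasurable; fun_prop)]
  simpa using h.integrable_norm_pow'

/-- `f` is integrable with integral `I`. -/
structure HasMean {Ω E : Type*} [MeasurableSpace Ω] [NormedAddCommGroup E] [NormedSpace ℝ E]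
    (P : Measure Ω) (f : Ω → E) (I : E) : Prop where
  integrable : Integrable f P
  eq : ∫ ω, f ω ∂P = I

namespace HasMean

section

variable {Ω E : Type*} [MeasurableSpace Ω] [NormedAddCommGroup E] [NormedSpace ℝ E]
  {P : Measure Ω} {f g : Ω → E} {I J : E}

lemma add (hf : HasMean P f I) (hg : HasMean P g J) : HasMean P (fun ω => f ω + g ω) (I + J) :=
  ⟨hf.1.add hg.1, by rw [integral_add hf.1 hg.1, hf.2, hg.2]⟩

lemma sub (hf : HasMean P f I) (hg : HasMean P g J) : HasMean P (fun ω => f ω - g ω) (I - J) :=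
  ⟨hf.1.sub hg.1, by rw [integral_sub hf.1 hg.1, hf.2, hg.2]⟩

lemma sum {ι : Type*} {F : ι → Ω → E} {K : ι → E} (s : Finset ι)
    (h : ∀ i ∈ s, HasMean P (F i) (K i)) : HasMean P (fun ω => ∑ i ∈ s, F i ω) (∑ i ∈ s, K i) :=
  ⟨integrable_finsetSum _ fun i hi => (h i hi).1, by
    rw [integral_finsetSum _ fun i hi => (h i hi).1]
    exact Finset.sum_congr rfl fun i hi => (h i hi).2⟩

lemma const [IsProbabilityMeasure P] (c : E) [CompleteSpace E] : HasMean P (fun _ => c) c :=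
  ⟨integrable_const c, by simp⟩

lemma congr (hf : HasMean P f I) (h : ∀ ω, g ω = f ω) (hIJ : J = I) : HasMean P g J := by
  rwa [funext h, hIJ]

end

lemma const_mul {Ω 𝕜 : Type*} [MeasurableSpace Ω] [RCLike 𝕜] {P : Measure Ω} {f : Ω → 𝕜} {I : 𝕜}
    (hf : HasMean P f I) (c : 𝕜) : HasMean P (fun ω => c * f ω) (c * I) :=
  ⟨hf.1.const_mul c, by rw [integral_const_mul, hf.2]⟩

lemma mono {Ω : Type*} [MeasurableSpace Ω] {P : Measure Ω} {f g : Ω → ℝ} {I J : ℝ}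
    (hf : HasMean P f I) (hg : HasMean P g J) (h : ∀ ω, f ω ≤ g ω) : I ≤ J := by
  rw [← hf.2, ← hg.2]; exact integral_mono hf.1 hg.1 h

lemma mul_of_indepFun {Ω 𝕜 : Type*} [MeasurableSpace Ω] [RCLike 𝕜] {P : Measure Ω} {f g : Ω → 𝕜}
    {I J : 𝕜} (h : IndepFun f g P) (hf : HasMean P f I) (hg : HasMean P g J) :
    HasMean P (fun ω => f ω * g ω) (I * J) :=
  ⟨h.integrable_mul hf.1 hg.1, by
    rw [h.integral_fun_mul_eq_mul_integral hf.1.aestronglyMeasurable hg.1.aestronglyMeasurable,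
      hf.2, hg.2]⟩

end HasMean

lemma MeasureTheory.MemLp.hasMean_pow {Ω : Type*} [MeasurableSpace Ω] {P : Measure Ω}
    [IsProbabilityMeasure P] {X : Ω → ℝ} (hX : MemLp X 4 P) {k : ℕ} (hk : k ≤ 4) :
    HasMean P (fun ω => X ω ^ k) (∫ ω, X ω ^ k ∂P) :=
  ⟨integrable_pow_of_memLp_four hX hk, rfl⟩

lemma ProbabilityTheory.IndepFun.hasMean_pow_mul_pow {Ω : Type*} [MeasurableSpace Ω]
    {P : Measure Ω} [IsProbabilityMeasure P] {X Y : Ω → ℝ} (h : IndepFun X Y P) (hX : MemLp X 4 P)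
    (hY : MemLp Y 4 P) {i j : ℕ} (hi : i ≤ 4) (hj : j ≤ 4) :
    HasMean P (fun ω => X ω ^ i * Y ω ^ j) ((∫ ω, X ω ^ i ∂P) * ∫ ω, Y ω ^ j ∂P) :=
  .mul_of_indepFun (h.comp (φ := fun x => x ^ i) (ψ := fun x => x ^ j) (by fun_prop) (by fun_prop))
    (hX.hasMean_pow hi) (hY.hasMean_pow hj)

/-! ### Moments of linear and quadratic forms in independent variables -/

/-- An independent family of centred real random variables of unit variance whose fourth moments
are bounded by `m`. -/
structure IsStdFamily {ι Ω : Type*} [MeasurableSpace Ω] (z : ι → Ω → ℝ) (P : Measure Ω)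
    (m : ℝ) : Prop where
  meas : ∀ i, Measurable (z i)
  indep : iIndepFun z P
  mean : ∀ i, ∫ ω, z i ω ∂P = 0
  sq : ∀ i, ∫ ω, z i ω ^ 2 ∂P = 1
  memLp : ∀ i, MemLp (z i) 4 P
  four : ∀ i, ∫ ω, z i ω ^ 4 ∂P ≤ m

namespace IsStdFamily

variable {ι Ω : Type*} [MeasurableSpace Ω] {z : ι → Ω → ℝ} {P : Measure Ω} {m : ℝ}

lemma hasMean_pow [IsProbabilityMeasure P] (hz : IsStdFamily z P m) (i : ι) {k : ℕ} (hk : k ≤ 4) :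
    HasMean P (fun ω => z i ω ^ k) (∫ ω, z i ω ^ k ∂P) := (hz.memLp i).hasMean_pow hk

lemma hasMean_sq [IsProbabilityMeasure P] (hz : IsStdFamily z P m) (i : ι) :
    HasMean P (fun ω => z i ω ^ 2) 1 :=
  ⟨integrable_pow_of_memLp_four (hz.memLp i) (by norm_num), hz.sq i⟩

lemma hasMean [IsProbabilityMeasure P] (hz : IsStdFamily z P m) (i : ι) :
    HasMean P (z i) 0 :=
  ⟨(hz.memLp i).integrable (by norm_num), hz.mean i⟩

lemma one_le_four [IsProbabilityMeasure P] (hz : IsStdFamily z P m) (i : ι) :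
    1 ≤ ∫ ω, z i ω ^ 4 ∂P := by
  have := (HasMean.const (0 : ℝ)).mono (((hz.hasMean_pow i le_rfl).sub
    ((hz.hasMean_sq i).const_mul 2)).add (.const 1)) fun ω => by nlinarith [sq_nonneg (z i ω ^ 2 - 1)]
  linarith

lemma one_le [IsProbabilityMeasure P] (hz : IsStdFamily z P m) (i : ι) : 1 ≤ m :=
  (hz.one_le_four i).trans (hz.four i)

/-- Follows from |x|³ ≤ (x² + x⁴)/2 together with 1 ≤ m. -/
lemma abs_third_le [IsProbabilityMeasure P] (hz : IsStdFamily z P m) (i : ι) :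
    |∫ ω, z i ω ^ 3 ∂P| ≤ m := by
  have h := HasMean.mono ⟨(hz.hasMean_pow i (k := 3) (by norm_num)).1.abs, rfl⟩
    (((hz.hasMean_sq i).add (hz.hasMean_pow i le_rfl)).const_mul (1 / 2)) fun ω => by
      rw [abs_le]
      constructor <;> nlinarith [sq_nonneg (z i ω * (z i ω - 1)), sq_nonneg (z i ω * (z i ω + 1))]
  linarith [abs_integral_le_integral_abs (f := fun ω => z i ω ^ 3) (μ := P), hz.four i, hz.one_le i]

/-- The vector of the variables with index in `s` is independent of `z k` for `k ∉ s`. -/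
lemma indepFun_vec [DecidableEq ι] (hz : IsStdFamily z P m) {s : Finset ι} {k : ι} (hk : k ∉ s) :
    IndepFun (z k) (fun ω i => if i ∈ s then z i ω else 0) P := by
  have h := hz.indep.indepFun_finset {k} s (by simpa using hk) hz.meas
  have hφ : Measurable fun x : ({k} : Finset ι) → ℝ => x ⟨k, by simp⟩ := measurable_pi_apply _
  have hψ : Measurable fun (x : s → ℝ) (i : ι) => if hi : i ∈ s then x ⟨i, hi⟩ else 0 :=
    measurable_pi_lambda _ fun i => by
      by_cases hi : i ∈ s
      · simpa only [hi, dite_true] using measurable_pi_apply _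
      · simp only [hi, dite_false]; fun_prop
  have := h.comp hφ hψ
  have e : (fun ω i => if i ∈ s then z i ω else 0) =
      (fun (x : s → ℝ) (i : ι) => if hi : i ∈ s then x ⟨i, hi⟩ else 0) ∘ fun ω i => z i ω := by
    funext ω i
    by_cases hi : i ∈ s <;> simp [hi]
  rw [e]
  exact this

/-- Setting the coordinates outside `s` to zero lets `g` be any measurable function on the full
space `ι → ℝ`, with no subtype in the applications. -/
lemma indepFun_comp [DecidableEq ι] (hz : IsStdFamily z P m) {s : Finset ι} {k : ι} (hk : k ∉ s)
    {β : Type*} [MeasurableSpace β] {g : (ι → ℝ) → β} (hg : Measurable g) :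
    IndepFun (z k) (fun ω => g fun i => if i ∈ s then z i ω else 0) P :=
  (hz.indepFun_vec hk).comp (φ := id) measurable_id hg

lemma indepFun_lin [DecidableEq ι] (hz : IsStdFamily z P m) {s : Finset ι} {k : ι} (hk : k ∉ s)
    (b : ι → ℝ) : IndepFun (z k) (fun ω => ∑ j ∈ s, b j * z j ω) P := by
  have := hz.indepFun_comp hk (g := fun x => ∑ j ∈ s, b j * x j) (by fun_prop)
  convert this using 2
  exact Finset.sum_congr rfl fun j hj => by simp [hj]

lemma memLp_lin (hz : IsStdFamily z P m) (s : Finset ι) (b : ι → ℝ) :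
    MemLp (fun ω => ∑ j ∈ s, b j * z j ω) 4 P :=
  memLp_finsetSum s fun j _ => (hz.memLp j).const_mul (b j)

variable [IsProbabilityMeasure P]

lemma hasMean_lin (hz : IsStdFamily z P m) (s : Finset ι) (b : ι → ℝ) :
    HasMean P (fun ω => ∑ j ∈ s, b j * z j ω) 0 :=
  (HasMean.sum s fun j _ => (hz.hasMean j).const_mul (b j)).congr (fun _ => rfl) (by simp)

lemma hasMean_lin_sq (hz : IsStdFamily z P m) (s : Finset ι) (b : ι → ℝ) :
    HasMean P (fun ω => (∑ j ∈ s, b j * z j ω) ^ 2) (∑ j ∈ s, b j ^ 2) := by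
  classical
  induction s using Finset.induction_on with
  | empty => simpa using HasMean.const (P := P) (0 : ℝ)
  | insert k s hk ih =>
    simp only [Finset.sum_insert hk]
    refine ((((hz.hasMean_sq k).const_mul (b k ^ 2)).add (((hz.indepFun_lin hk b).hasMean_pow_mul_pow
      (hz.memLp k) (hz.memLp_lin s b) (i := 1) (j := 1) (by norm_num) (by norm_num)).const_mul
      (2 * b k))).add ih).congr (fun ω => by ring) ?_
    simp [hz.mean]

/-- Add one variable at a time. The terms of odd degree vanish because both the new variable and the
old sum L are centred. What remains is b⁴ E z⁴ + 6 b² E L² + E L⁴, and 1 ≤ m lets it fit under 3m(b²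
+ ∑ b_j²)². -/
lemma integral_lin_four_le (hz : IsStdFamily z P m) (s : Finset ι) (b : ι → ℝ) :
    ∫ ω, (∑ j ∈ s, b j * z j ω) ^ 4 ∂P ≤ 3 * m * (∑ j ∈ s, b j ^ 2) ^ 2 := by
  classical
  induction s using Finset.induction_on with
  | empty => simp
  | insert k s hk ih =>
    have hL := hz.memLp_lin s b
    have h := fun i j (hi' : i ≤ 4) (hj' : j ≤ 4) =>
      (hz.indepFun_lin hk b).hasMean_pow_mul_pow (hz.memLp k) hL (i := i) (j := j) hi' hj'
    simp only [Finset.sum_insert hk]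
    have H := (((((hz.hasMean_pow k le_rfl).const_mul (b k ^ 4)).add
      ((h 3 1 (by norm_num) (by norm_num)).const_mul (4 * b k ^ 3))).add
      ((h 2 2 (by norm_num) (by norm_num)).const_mul (6 * b k ^ 2))).add
      ((h 1 3 (by norm_num) (by norm_num)).const_mul (4 * b k))).add (hL.hasMean_pow le_rfl)
    rw [(H.congr (g := fun ω => (b k * z k ω + ∑ j ∈ s, b j * z j ω) ^ 4)
      (fun ω => by ring) rfl).eq]
    simp only [pow_one, hz.mean, zero_mul, hz.sq, (hz.hasMean_lin_sq s b).eq, (hz.hasMean_lin s b).eq,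
      mul_zero, one_mul]
    set S := ∑ j ∈ s, b j ^ 2 with hS
    have hm := hz.one_le k
    have hS0 : 0 ≤ S := Finset.sum_nonneg fun j _ => sq_nonneg _
    have := mul_le_mul_of_nonneg_left (hz.four k) (by positivity : 0 ≤ b k ^ 4)
    have h5 : 0 ≤ (m - 1) * (b k ^ 2 * S) := mul_nonneg (by linarith) (by positivity)
    have h6 : 0 ≤ m * b k ^ 4 := by positivity
    nlinarith

omit [IsProbabilityMeasure P] in
-- The pair is treated jointly, since later steps need independence from functions mixing both
-- components, such as their product.
lemma indepFun_quad_lin [DecidableEq ι] (hz : IsStdFamily z P m) {s : Finset ι} {k : ι}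
    (hk : k ∉ s) (b : ι → ℝ) (M : ι → ι → ℝ) (c : ℝ) :
    IndepFun (z k) (fun ω => (∑ i ∈ s, ∑ j ∈ s, M i j * (z i ω * z j ω) - c,
      ∑ j ∈ s, b j * z j ω)) P := by
  have := hz.indepFun_comp hk (g := fun x => (∑ i ∈ s, ∑ j ∈ s, M i j * (x i * x j) - c,
      ∑ j ∈ s, b j * x j)) (by fun_prop)
  convert this using 2
  congr 1
  · congr 1
    exact Finset.sum_congr rfl fun i hi => Finset.sum_congr rfl fun j hj => by simp [hi, hj]
  · exact Finset.sum_congr rfl fun j hj => by simp [hj]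

omit [IsProbabilityMeasure P] in
lemma memLp_mul (hz : IsStdFamily z P m) (i j : ι) : MemLp (fun ω => z i ω * z j ω) 2 P := by
  have : ENNReal.HolderTriple 4 4 2 := ⟨by
    rw [← ENNReal.toReal_eq_toReal_iff' (by simp) (by simp)]
    rw [ENNReal.toReal_add (by simp) (by simp)]; norm_num⟩
  exact (hz.memLp j).mul (hz.memLp i)

lemma memLp_quad (hz : IsStdFamily z P m) (s : Finset ι) (M : ι → ι → ℝ) (c : ℝ) :
    MemLp (fun ω => ∑ i ∈ s, ∑ j ∈ s, M i j * (z i ω * z j ω) - c) 2 P :=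
  (memLp_finsetSum s fun i _ => memLp_finsetSum s fun j _ =>
    (hz.memLp_mul i j).const_mul (M i j)).sub (memLp_const c)

/-- Adding the variable z_k increases the form q by M_kk(z_k² - 1) + 2 z_k l, with l linear in the
earlier variables. The increment has mean zero given those variables, so it is orthogonal to q, and
its second moment is M_kk²(E z_k⁴ - 1) + 4 ∑ M_kj². -/
lemma integral_quad_sq_le (hz : IsStdFamily z P m) (s : Finset ι) (M : ι → ι → ℝ)
    (hM : ∀ i j, M i j = M j i) :
    ∫ ω, (∑ i ∈ s, ∑ j ∈ s, M i j * (z i ω * z j ω) - ∑ i ∈ s, M i i) ^ 2 ∂P ≤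
      2 * m * ∑ i ∈ s, ∑ j ∈ s, M i j ^ 2 := by
  classical
  induction s using Finset.induction_on with
  | empty => simp
  | insert k s hk ih =>
    set S := ∑ i ∈ s, M i i with hS
    set q : Ω → ℝ := fun ω => ∑ i ∈ s, ∑ j ∈ s, M i j * (z i ω * z j ω) - S with hq
    set l : Ω → ℝ := fun ω => ∑ j ∈ s, M k j * z j ω with hl
    have hqL : MemLp q 2 P := hz.memLp_quad s M S
    have hlL : MemLp l 4 P := hz.memLp_lin s (M k)
    have hlL2 : MemLp l 2 P := hlL.mono_exponent (by norm_num)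
    have hind := hz.indepFun_quad_lin hk (M k) M S
    have hil : IndepFun (z k) l P := hz.indepFun_lin hk (M k)
    have h := fun i j (hi' : i ≤ 4) (hj' : j ≤ 4) =>
      hil.hasMean_pow_mul_pow (hz.memLp k) hlL (i := i) (j := j) hi' hj'
    have i1 : IndepFun (z k) (fun ω => q ω * l ω) P :=
      hind.comp (φ := id) (ψ := fun p : ℝ × ℝ => p.1 * p.2) measurable_id (by fun_prop)
    have i2 : IndepFun (fun ω => z k ω ^ 2 - 1) q P :=
      hind.comp (φ := fun x => x ^ 2 - 1) (ψ := Prod.fst) (by fun_prop) (by fun_prop)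
    have a1 := HasMean.mul_of_indepFun i1 (hz.hasMean k) ⟨hqL.integrable_mul hlL2, rfl⟩
    have a2 := HasMean.mul_of_indepFun i2 ((hz.hasMean_sq k).sub (.const 1))
      ⟨hqL.integrable (by norm_num), rfl⟩
    have a3 : HasMean P (fun ω => q ω ^ 2) (∫ ω, q ω ^ 2 ∂P) := ⟨hqL.integrable_sq, rfl⟩
    have H := ((((((((a3.add (a1.const_mul 4)).add (a2.const_mul (2 * M k k))).add
      ((h 2 2 (by norm_num) (by norm_num)).const_mul 4)).add
      ((h 3 1 (by norm_num) (by norm_num)).const_mul (4 * M k k))).sub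
      ((h 1 1 (by norm_num) (by norm_num)).const_mul (4 * M k k))).add
      ((hz.hasMean_pow k le_rfl).const_mul (M k k ^ 2))).sub
      ((hz.hasMean_sq k).const_mul (2 * M k k ^ 2))).add (.const (M k k ^ 2)))
    have hl0 : ∫ ω, l ω ∂P = 0 := (hz.hasMean_lin s (M k)).eq
    have hl2 : ∫ ω, l ω ^ 2 ∂P = ∑ j ∈ s, M k j ^ 2 := (hz.hasMean_lin_sq s (M k)).eq
    have e : ∀ ω, (∑ i ∈ insert k s, ∑ j ∈ insert k s, M i j * (z i ω * z j ω) -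
        ∑ i ∈ insert k s, M i i) ^ 2 = q ω ^ 2 + 4 * (z k ω * (q ω * l ω)) +
          2 * M k k * ((z k ω ^ 2 - 1) * q ω) + 4 * (z k ω ^ 2 * l ω ^ 2) +
          4 * M k k * (z k ω ^ 3 * l ω) - 4 * M k k * (z k ω * l ω) +
          M k k ^ 2 * z k ω ^ 4 - 2 * M k k ^ 2 * z k ω ^ 2 + M k k ^ 2 := by
      intro ω
      have : ∑ i ∈ s, M i k * (z i ω * z k ω) = z k ω * l ω := by
        rw [hl, Finset.mul_sum]
        exact Finset.sum_congr rfl fun i _ => by rw [hM i k]; ring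
      have h' : ∑ j ∈ s, M k j * (z k ω * z j ω) = z k ω * l ω := by
        rw [hl, Finset.mul_sum]
        exact Finset.sum_congr rfl fun i _ => by ring
      simp only [Finset.sum_insert hk, Finset.sum_add_distrib, this, h']
      have : ∑ i ∈ s, ∑ j ∈ s, M i j * (z i ω * z j ω) = q ω + S := by simp [hq]
      rw [this]
      ring
    rw [(H.congr (fun ω => (e ω).trans (by ring)) rfl).eq]
    simp only [pow_one, hl0, hl2, hz.mean, hz.sq, mul_zero, zero_mul, one_mul]
    have hm := hz.one_le k
    have hsw : ∑ i ∈ s, M i k ^ 2 = ∑ j ∈ s, M k j ^ 2 :=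
      Finset.sum_congr rfl fun i _ => by rw [hM i k]
    simp only [Finset.sum_insert hk, Finset.sum_add_distrib, hsw]
    have h0 : 0 ≤ ∑ j ∈ s, M k j ^ 2 := Finset.sum_nonneg fun j _ => sq_nonneg _
    have h1 := mul_le_mul_of_nonneg_left (hz.four k) (sq_nonneg (M k k))
    have h2 : 0 ≤ (m - 1) * ∑ j ∈ s, M k j ^ 2 := mul_nonneg (by linarith) h0
    have h3 : 0 ≤ m * M k k ^ 2 := by positivity
    nlinarith [sq_nonneg (M k k)]

end IsStdFamily

/-! ### Taylor remainders and the leave-one-out estimate -/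

lemma norm_exp_mul_I_sub_one_le (x : ℝ) : ‖Complex.exp (x * Complex.I) - 1‖ ≤ |x| := by
  simpa [mul_comm] using Real.norm_exp_I_mul_ofReal_sub_one_le (x := x)

lemma norm_exp_mul_I_sub_one_sub_le (x : ℝ) :
    ‖Complex.exp (x * Complex.I) - 1 - x * Complex.I‖ ≤ 2 * |x| := by
  calc _ ≤ _ := norm_sub_le _ _
    _ ≤ |x| + |x| := add_le_add (norm_exp_mul_I_sub_one_le x) (by simp)
    _ = _ := by ring

lemma norm_exp_mul_I_sub_one_sub_le_sq (x : ℝ) :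
    ‖Complex.exp (x * Complex.I) - 1 - x * Complex.I‖ ≤ 2 * x ^ 2 := by
  rcases le_total |x| 1 with h | h
  · have := Complex.norm_exp_sub_one_sub_id_le (x := x * Complex.I) (by simpa using h)
    refine this.trans ?_
    simp only [norm_mul, Complex.norm_real, Complex.norm_I, mul_one, Real.norm_eq_abs, sq_abs]
    nlinarith [sq_nonneg x]
  · refine (norm_exp_mul_I_sub_one_sub_le x).trans ?_
    rw [← sq_abs]
    nlinarith

/-- Second order Taylor remainder, weighted by a comparable quantity: the `α`-part is only
controlled by a truncated second moment. -/
lemma abs_mul_taylor_remainder_le {α β u d τ s C ε w : ℝ} (hs : 0 < s) (hτ : |τ| ≤ 1 / s)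
    (hC : 1 ≤ C) (hε : 0 ≤ ε) (_hw : 0 ≤ w) (hα : |α| ≤ C * w) (hu : |u| ≤ |α| + |β|)
    (hd : |d| ≤ |α| + |β|) :
    |u| * ‖Complex.exp ((τ * d : ℝ) * Complex.I) - 1 - (τ * d : ℝ) * Complex.I‖ ≤
      8 * (1 / s ^ 2) * (β ^ 2 + β ^ 4) +
        (1 / s) * (16 * C ^ 3 * ε * w ^ 2 + 8 * C ^ 2 * (if ε * s < w then w ^ 2 else 0)) := by
  have h1 := norm_exp_mul_I_sub_one_sub_le (τ * d)
  have h2 := norm_exp_mul_I_sub_one_sub_le_sq (τ * d)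
  set T := ‖Complex.exp ((τ * d : ℝ) * Complex.I) - 1 - (τ * d : ℝ) * Complex.I‖
  have hT : 0 ≤ T := norm_nonneg _
  have hτ2 : τ ^ 2 ≤ 1 / s ^ 2 := by
    rw [← sq_abs, ← one_div_pow]; exact pow_le_pow_left₀ (abs_nonneg _) hτ 2
  have hs2 : 0 < 1 / s ^ 2 := by positivity
  have hs1 : 0 < 1 / s := by positivity
  have hβ2 : |β| ^ 3 ≤ (β ^ 2 + β ^ 4) / 2 := by
    rw [← sq_abs, ← (by decide : Even 4).pow_abs]
    nlinarith [sq_nonneg (|β| * (|β| - 1))]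
  have hR : 0 ≤ (if ε * s < w then w ^ 2 else 0) := by split_ifs <;> positivity
  have hbd : 0 ≤ 8 * (1 / s ^ 2) * (β ^ 2 + β ^ 4) := by positivity
  have quad : ∀ y, |u| ≤ y → |d| ≤ y → |u| * T ≤ 2 * (1 / s ^ 2) * y ^ 3 := fun y hy hy' => by
    have hy0 : 0 ≤ y := (abs_nonneg _).trans hy
    have : T ≤ 2 * ((1 / s ^ 2) * y ^ 2) := by
      refine h2.trans ?_
      have hd2 : d ^ 2 ≤ y ^ 2 := by
        rw [← sq_abs]; exact pow_le_pow_left₀ (abs_nonneg _) hy' 2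
      rw [mul_pow]
      gcongr
    calc |u| * T ≤ y * (2 * ((1 / s ^ 2) * y ^ 2)) := by gcongr
      _ = _ := by ring
  have lin : ∀ y, |u| ≤ y → |d| ≤ y → |u| * T ≤ 2 * (1 / s) * y ^ 2 := fun y hy hy' => by
    have hy0 : 0 ≤ y := (abs_nonneg _).trans hy
    have : T ≤ 2 * ((1 / s) * y) := by
      refine h1.trans ?_
      rw [abs_mul]
      gcongr
    calc |u| * T ≤ y * (2 * ((1 / s) * y)) := by gcongr
      _ = _ := by ring
  -- Both |u| and |d| are at most twice the larger of |α|, |β|. If β dominates, the cubic bound is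
  -- affordable. If α dominates and w exceeds the threshold εs, the bound must stay quadratic in w;
  -- below the threshold one factor w ≤ εs is traded to turn 1/s² into ε/s.
  rcases le_total |α| |β| with h | h
  · have := quad (2 * |β|) (by linarith) (by linarith)
    have h3 : 0 ≤ (1 / s) * (16 * C ^ 3 * ε * w ^ 2 +
      8 * C ^ 2 * (if ε * s < w then w ^ 2 else 0)) := by positivity
    have h4 := mul_le_mul_of_nonneg_left hβ2 (by positivity : 0 ≤ 16 * (1 / s ^ 2))
    nlinarith
  · by_cases hw' : ε * s < w
    · have := lin (2 * (C * w)) (by linarith) (by linarith)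
      have h3 : 0 ≤ (1 / s) * (16 * C ^ 3 * ε * w ^ 2) := by positivity
      simp only [hw', if_true] at *
      nlinarith
    · have := quad (2 * (C * w)) (by linarith) (by linarith)
      have h3 : (1 / s ^ 2) * w ≤ (1 / s) * ε := by
        calc (1 / s ^ 2) * w ≤ (1 / s ^ 2) * (ε * s) := by gcongr; exact not_lt.1 hw'
          _ = (1 / s) * ε := by field_simp
      have h4 := mul_le_mul_of_nonneg_left h3 (by positivity : 0 ≤ 16 * C ^ 3 * w ^ 2)
      simp only [hw', if_false] at *
      nlinarith

lemma sq_add_add_le (x y z : ℝ) : (x + y + z) ^ 2 ≤ 3 * (x ^ 2 + y ^ 2 + z ^ 2) := by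
  nlinarith [sq_nonneg (x - y), sq_nonneg (x - z), sq_nonneg (y - z)]

section

variable {Ω : Type*} [MeasurableSpace Ω] {P : Measure Ω} [IsProbabilityMeasure P]

set_option maxHeartbeats 1000000 in
/-- Leave-one-out expansion of a characteristic function of a quadratic form in one variable `X`,
the rest of the form being encoded in `h` and `e`. -/
theorem norm_integral_leave_one_out_le {X h : Ω → ℝ} {e : Ω → ℂ} {a m C τ s ε : ℝ}
    (hind : IndepFun X (fun ω => (h ω, e ω)) P) (hXm : Measurable X) (hhm : Measurable h)
    (hem : Measurable e) (hX : MemLp X 4 P) (hh : MemLp h 4 P) (he : ∀ ω, ‖e ω‖ = 1)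
    (hX1 : ∫ ω, X ω ∂P = 0) (hX2 : ∫ ω, X ω ^ 2 ∂P = 1) (hX3 : |∫ ω, X ω ^ 3 ∂P| ≤ m)
    (hX4 : ∫ ω, X ω ^ 4 ∂P ≤ m) (hX4' : 1 ≤ ∫ ω, X ω ^ 4 ∂P)
    (hh2 : ∫ ω, h ω ^ 2 ∂P ≤ C ^ 2) (hh4 : ∫ ω, h ω ^ 4 ∂P ≤ 3 * m * C ^ 4)
    (hC : 1 ≤ C) (ha : |a| ≤ C) (hs : 0 < s) (hτ : |τ| ≤ 1 / s) (hε : 0 ≤ ε) :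
    ‖∫ ω, (((a * (X ω ^ 2 - 1) + X ω * h ω : ℝ) : ℂ) - τ * Complex.I *
        ((a ^ 2 * ((∫ ω, X ω ^ 4 ∂P) - 1) + 3 * a * (∫ ω, X ω ^ 3 ∂P) * h ω + 2 * h ω ^ 2 : ℝ) : ℂ)) *
        (e ω * Complex.exp ((τ * (a * (X ω ^ 2 - 1) + 2 * X ω * h ω) : ℝ) * Complex.I)) ∂P‖ ≤
      500 * C ^ 4 * m ^ 2 * (1 / s ^ 2) + (1 / s) * (16 * C ^ 3 * ε * m + 8 * C ^ 2 *
        ∫ ω in {ω | ε * s < |(|X ω| ^ 2 - 1)|}, |(|X ω| ^ 2 - 1)| ^ 2 ∂P) := by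
  set m3 := ∫ ω, X ω ^ 3 ∂P with hm3
  set m4 := ∫ ω, X ω ^ 4 ∂P with hm4
  have hm : 1 ≤ m := hX4'.trans hX4
  -- the moments of `X`
  have x0 : HasMean P (fun ω => X ω) 0 := ⟨hX.integrable (by norm_num), hX1⟩
  have x2 : HasMean P (fun ω => X ω ^ 2) 1 := ⟨integrable_pow_of_memLp_four hX (by norm_num), hX2⟩
  have x3 : HasMean P (fun ω => X ω ^ 3) m3 := hX.hasMean_pow (by norm_num)
  have x4 : HasMean P (fun ω => X ω ^ 4) m4 := hX.hasMean_pow le_rfl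
  have y2 : HasMean P (fun ω => h ω ^ 2) _ := hh.hasMean_pow (by norm_num)
  have y4 : HasMean P (fun ω => h ω ^ 4) _ := hh.hasMean_pow le_rfl
  -- products with functions of the rest
  have key : ∀ (f : ℝ → ℝ) (I : ℝ) (n : ℕ) (b : ℝ), Measurable f → n ≤ 4 →
      HasMean P (fun ω => f (X ω)) I →
      HasMean P (fun ω => ((f (X ω) : ℝ) : ℂ) * ((b * h ω ^ n : ℝ) * e ω))
        (I * ∫ ω, ((b * h ω ^ n : ℝ) * e ω) ∂P) := by
    intro f I n b hf hn hI
    refine HasMean.mul_of_indepFun ?_ ⟨hI.1.ofReal, ?_⟩ ⟨?_, rfl⟩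
    · exact hind.comp (φ := fun x => ((f x : ℝ) : ℂ))
        (ψ := fun p : ℝ × ℂ => ((b * p.1 ^ n : ℝ) : ℂ) * p.2) (by fun_prop) (by fun_prop)
    · exact integral_ofReal.trans (congrArg _ hI.2)
    · refine ((integrable_pow_of_memLp_four hh hn).const_mul b).ofReal.mul_bdd (c := 1)
        hem.aestronglyMeasurable (.of_forall fun ω => (he ω).le)
  have key' : ∀ (n : ℕ) (b : ℝ), n ≤ 4 →
      HasMean P (fun ω => ((b * h ω ^ n : ℝ) * e ω)) (∫ ω, ((b * h ω ^ n : ℝ) * e ω) ∂P) := by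
    intro n b hn
    exact ⟨((integrable_pow_of_memLp_four hh hn).const_mul b).ofReal.mul_bdd (c := 1)
        hem.aestronglyMeasurable (.of_forall fun ω => (he ω).le), rfl⟩
  have v1 := key (fun x => x ^ 2 - 1) _ 0 a (by fun_prop) (by norm_num) (x2.sub (.const 1))
  have v2 := key (fun x => x) _ 1 1 (by fun_prop) (by norm_num) x0
  have w1 := key (fun x => x ^ 4 - 2 * x ^ 2 + 1) _ 0 (a ^ 2) (by fun_prop) (by norm_num)
    ((x4.sub (x2.const_mul 2)).add (.const 1))
  have w2 := key (fun x => x ^ 3 - x) _ 1 (3 * a) (by fun_prop) (by norm_num) (x3.sub x0)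
  have w3 := key (fun x => x ^ 2) _ 2 2 (by fun_prop) (by norm_num) x2
  have c1 := key' 0 (a ^ 2 * (m4 - 1)) (by norm_num)
  have c2 := key' 1 (3 * a * m3) (by norm_num)
  have c3 := key' 2 2 (by norm_num)
  have zero := (v1.add v2).add ((((w1.add w2).add w3).sub ((c1.add c2).add c3)).const_mul
    (τ * Complex.I))
  set U : Ω → ℝ := fun ω => a * (X ω ^ 2 - 1) + X ω * h ω with hU
  set D : Ω → ℝ := fun ω => a * (X ω ^ 2 - 1) + 2 * X ω * h ω with hD
  set c : Ω → ℝ := fun ω => a ^ 2 * (m4 - 1) + 3 * a * m3 * h ω + 2 * h ω ^ 2 with hc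
  -- Given (h, e), U has mean zero and U·D has mean c, the coefficient of h coming from E[X(X² - 1)]
  -- = E X³. Hence the first-order expansion integrates to exactly zero, and subtracting it leaves
  -- only remainders.
  have F0 : HasMean P (fun ω => (U ω : ℂ) * e ω + τ * Complex.I * ((U ω * D ω - c ω : ℝ) * e ω))
      0 := by
    refine zero.congr (fun ω => ?_) ?_
    · simp only [hU, hD, hc]
      push_cast
      ring
    · simp only [Complex.ofReal_mul, mul_assoc, integral_const_mul]
      push_cast
      ring
  -- the dominating function
  have hXh : IndepFun X h P := hind.comp (φ := id) (ψ := Prod.fst) measurable_id measurable_fst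
  have z22 := hXh.hasMean_pow_mul_pow hX hh (i := 2) (j := 2) (by norm_num) (by norm_num)
  have z44 := hXh.hasMean_pow_mul_pow hX hh (i := 4) (j := 4) (by norm_num) (by norm_num)
  rw [← hm4] at z44
  rw [hX2] at z22
  set W : Set Ω := {ω | ε * s < |(|X ω| ^ 2 - 1)|} with hW
  have hWm : MeasurableSet W := measurableSet_lt (by fun_prop) (by fun_prop)
  have xw : HasMean P (fun ω => |(|X ω| ^ 2 - 1)| ^ 2) (m4 - 2 * 1 + 1) :=
    ((x4.sub (x2.const_mul 2)).add (.const 1)).congr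
      (fun ω => by rw [sq_abs, sq_abs]; ring) rfl
  have xW : HasMean P (fun ω => if ε * s < |(|X ω| ^ 2 - 1)| then |(|X ω| ^ 2 - 1)| ^ 2 else 0)
      (∫ ω in W, |(|X ω| ^ 2 - 1)| ^ 2 ∂P) := by
    have : (fun ω => if ε * s < |(|X ω| ^ 2 - 1)| then |(|X ω| ^ 2 - 1)| ^ 2 else 0) =
        W.indicator (fun ω => |(|X ω| ^ 2 - 1)| ^ 2) := by
      funext ω; simp [Set.indicator, hW]
    rw [this]
    exact ⟨xw.1.indicator hWm, integral_indicator hWm⟩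
  set ℓ := ∫ ω in W, |(|X ω| ^ 2 - 1)| ^ 2 ∂P
  have H := (((((((y2.const_mul (9 * C ^ 2 * m ^ 2)).add (y4.const_mul 4)).add
    (.const (C ^ 4 * m ^ 2))).const_mul (3 / 2)).add
    ((xw.const_mul (C ^ 2)).add (z22.const_mul 4))).const_mul (1 / s ^ 2)).add
    (((z22.const_mul 4).add (z44.const_mul 16)).const_mul (8 * (1 / s ^ 2)))).add
    (((xw.const_mul (16 * C ^ 3 * ε)).add (xW.const_mul (8 * C ^ 2))).const_mul (1 / s))
  have hτ2 : τ ^ 2 ≤ 1 / s ^ 2 := by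
    rw [← sq_abs, ← one_div_pow]; exact pow_le_pow_left₀ (abs_nonneg _) hτ 2
  have ha2 : a ^ 2 ≤ C ^ 2 := sq_le_sq' (by linarith [neg_abs_le a]) (by linarith [le_abs_self a])
  have hm32 : m3 ^ 2 ≤ m ^ 2 :=
    sq_le_sq' (by linarith [neg_abs_le m3]) (by linarith [le_abs_self m3])
  set E : Ω → ℂ := fun ω => e ω * Complex.exp ((τ * D ω : ℝ) * Complex.I) with hE
  have hEn : ∀ ω, ‖E ω‖ = 1 := fun ω => by rw [hE]; simp [he, Complex.norm_exp]
  have hEm : Measurable E := by rw [hE, hD]; fun_prop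
  have uL : Integrable U P := by
    have := ((x2.sub (.const 1)).const_mul a).add
      (hXh.hasMean_pow_mul_pow hX hh (i := 1) (j := 1) (by norm_num) (by norm_num))
    simpa only [pow_one] using this.1
  have cL : Integrable c P :=
    (((HasMean.const (P := P) (a ^ 2 * (m4 - 1))).add ((hh.hasMean_pow (k := 1)
      (by norm_num)).const_mul (3 * a * m3))).add (y2.const_mul 2)).1.congr
      (.of_forall fun ω => by simp [hc])
  have hF : Integrable (fun ω => ((U ω : ℂ) - τ * Complex.I * (c ω : ℂ)) * E ω) P :=
    (uL.ofReal.sub (cL.ofReal.const_mul _)).mul_bdd (c := 1) hEm.aestronglyMeasurable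
      (.of_forall fun ω => (hEn ω).le)
  have hle : ∀ {g : Ω → ℝ} {K : ℝ}, HasMean P g K →
      (∀ ω, ‖((U ω : ℂ) - τ * Complex.I * (c ω : ℂ)) * E ω -
        ((U ω : ℂ) * e ω + τ * Complex.I * ((U ω * D ω - c ω : ℝ) * e ω))‖ ≤ g ω) →
      ‖∫ ω, ((U ω : ℂ) - τ * Complex.I * (c ω : ℂ)) * E ω ∂P‖ ≤ K := by
    intro g K hg hgle
    have h0 := (HasMean.sub (I := ∫ ω, ((U ω : ℂ) - τ * Complex.I * (c ω : ℂ)) * E ω ∂P)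
      ⟨hF, rfl⟩ F0)
    rw [sub_zero] at h0
    rw [← h0.2]
    exact (norm_integral_le_of_norm_le hg.1 (.of_forall hgle)).trans hg.2.le
  refine (hle H fun ω => ?_).trans ?_
  · -- the pointwise bound
    have t1 : ((U ω : ℂ) - τ * Complex.I * (c ω : ℂ)) * E ω -
        ((U ω : ℂ) * e ω + τ * Complex.I * ((U ω * D ω - c ω : ℝ) * e ω)) =
        e ω * ((U ω : ℂ) * (Complex.exp ((τ * D ω : ℝ) * Complex.I) - 1 -
          (τ * D ω : ℝ) * Complex.I)) -
        e ω * (τ * Complex.I * ((c ω : ℂ) * (Complex.exp ((τ * D ω : ℝ) * Complex.I) - 1))) := by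
      simp only [hE]; push_cast; ring
    -- The two pieces are U times a second-order remainder and τc times a first-order one. Each is
    -- of second order in τ, apart from the truncated part of U.
    rw [t1]
    refine (norm_sub_le _ _).trans ?_
    simp only [norm_mul, he, one_mul, Complex.norm_real, Complex.norm_I, Real.norm_eq_abs, mul_one]
    have g1 := abs_mul_taylor_remainder_le (α := a * (X ω ^ 2 - 1)) (β := 2 * X ω * h ω)
      (u := U ω) (d := D ω) (w := |(|X ω| ^ 2 - 1)|) hs hτ hC hε (abs_nonneg _)
      (by rw [abs_mul, sq_abs]; gcongr)
      ((abs_add_le _ _).trans (by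
        refine add_le_add_right ?_ _
        rw [mul_assoc, abs_mul 2, abs_two]
        linarith [abs_nonneg (X ω * h ω)]))
      (abs_add_le _ _)
    have g2 : |τ| * (|c ω| * ‖Complex.exp ((τ * D ω : ℝ) * Complex.I) - 1‖) ≤
        (1 / s ^ 2) * ((c ω ^ 2 + D ω ^ 2) / 2) := by
      calc |τ| * (|c ω| * ‖Complex.exp ((τ * D ω : ℝ) * Complex.I) - 1‖)
          ≤ |τ| * (|c ω| * |τ * D ω|) := by gcongr; exact norm_exp_mul_I_sub_one_le _
        _ = τ ^ 2 * (|c ω| * |D ω|) := by rw [abs_mul, ← sq_abs τ]; ring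
        _ ≤ (1 / s ^ 2) * (|c ω| * |D ω|) := by gcongr
        _ ≤ _ := by
          gcongr
          rw [← sq_abs (c ω), ← sq_abs (D ω)]
          nlinarith [sq_nonneg (|c ω| - |D ω|)]
    have g3 : c ω ^ 2 ≤ 3 * (C ^ 4 * m ^ 2 + 9 * C ^ 2 * m ^ 2 * h ω ^ 2 + 4 * h ω ^ 4) := by
      have q1 := sq_add_add_le (a ^ 2 * (m4 - 1)) (3 * a * m3 * h ω) (2 * h ω ^ 2)
      have q2 : (a ^ 2) ^ 2 * (m4 - 1) ^ 2 ≤ (C ^ 2) ^ 2 * m ^ 2 := by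
        gcongr
        all_goals linarith
      have q3 : 9 * a ^ 2 * m3 ^ 2 * h ω ^ 2 ≤ 9 * C ^ 2 * m ^ 2 * h ω ^ 2 := by gcongr
      refine q1.trans ?_
      linarith
    have g4 : D ω ^ 2 ≤ 2 * (C ^ 2 * |(|X ω| ^ 2 - 1)| ^ 2) + 2 * (4 * (X ω ^ 2 * h ω ^ 2)) := by
      rw [sq_abs, sq_abs]
      have : a ^ 2 * (X ω ^ 2 - 1) ^ 2 ≤ C ^ 2 * (X ω ^ 2 - 1) ^ 2 := by gcongr
      have q1 := add_sq_le (a := a * (X ω ^ 2 - 1)) (b := 2 * X ω * h ω)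
      refine q1.trans ?_
      linarith
    have g5 : (1 / s ^ 2) * ((c ω ^ 2 + D ω ^ 2) / 2) ≤ (1 / s ^ 2) * ((3 / 2) *
        (9 * C ^ 2 * m ^ 2 * h ω ^ 2 + 4 * h ω ^ 4 + C ^ 4 * m ^ 2) +
        (C ^ 2 * |(|X ω| ^ 2 - 1)| ^ 2 + 4 * (X ω ^ 2 * h ω ^ 2))) := by
      gcongr
      linarith
    refine (add_le_add g1 (g2.trans g5)).trans (le_of_eq ?_)
    ring
  clear H hle
  have hC2 : 1 ≤ C ^ 2 := one_le_pow₀ hC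
  have hCC : C ^ 2 ≤ C ^ 4 := by nlinarith
  have hmm : m ≤ m ^ 2 := by nlinarith
  have k1 : C ^ 2 ≤ C ^ 4 * m ^ 2 := by nlinarith [sq_nonneg (C ^ 2)]
  have k2 : C ^ 4 * m ≤ C ^ 4 * m ^ 2 := by gcongr
  have k3 : C ^ 2 * m ≤ C ^ 4 * m ^ 2 := by
    calc _ ≤ C ^ 4 * m := by gcongr
      _ ≤ _ := k2
  have r1 : 9 * C ^ 2 * m ^ 2 * ∫ ω, h ω ^ 2 ∂P ≤ 9 * C ^ 4 * m ^ 2 := by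
    calc _ ≤ 9 * C ^ 2 * m ^ 2 * C ^ 2 := by gcongr
      _ = _ := by ring
  have r2 : C ^ 2 * (m4 - 2 * 1 + 1) ≤ C ^ 2 * m := by gcongr; linarith
  have r3 : m4 * ∫ ω, h ω ^ 4 ∂P ≤ 3 * (C ^ 4 * m ^ 2) := by
    calc _ ≤ m * (3 * m * C ^ 4) := by gcongr
      _ = _ := by ring
  have r4 : 16 * C ^ 3 * ε * (m4 - 2 * 1 + 1) ≤ 16 * C ^ 3 * ε * m := by gcongr; linarith
  have f1 : ∀ x y : ℝ, x ≤ y → (1 / s) * x ≤ (1 / s) * y := fun x y hxy => by gcongr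
  have f2 : ∀ x y : ℝ, x ≤ y → (1 / s ^ 2) * x ≤ (1 / s ^ 2) * y := fun x y hxy => by gcongr
  have e1 := f1 _ _ (add_le_add_left r4 (8 * C ^ 2 * ℓ))
  -- In units of C⁴m² the three groups are at most 33, 5 and 416, whence 500.
  have e2 := f2 (3 / 2 * (9 * C ^ 2 * m ^ 2 * ∫ ω, h ω ^ 2 ∂P + 4 * ∫ ω, h ω ^ 4 ∂P +
    C ^ 4 * m ^ 2) + (C ^ 2 * (m4 - 2 * 1 + 1) + 4 * (1 * ∫ ω, h ω ^ 2 ∂P)) +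
    8 * (4 * (1 * ∫ ω, h ω ^ 2 ∂P) + 16 * (m4 * ∫ ω, h ω ^ 4 ∂P))) (500 * C ^ 4 * m ^ 2) (by
      linarith)
  linarith

end

/-! ### Differential inequality, operator bounds and fluctuations of conditional variances -/

/-- The off-diagonal part of a square array. -/
def offDiagPart {ι : Type*} [DecidableEq ι] (A : ι → ι → ℝ) (i j : ι) : ℝ :=
  if i = j then 0 else A i j

/-- Multiply by the integrating factor exp(vt²/2): the product has derivative at most η exp(v/2) on
[0, 1]. Dividing by the factor at t = 1 removes exp(v/2), so the bound is uniform in v. -/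
lemma norm_sub_exp_neg_le_of_deriv {φ φ' : ℝ → ℂ} {v η : ℝ} (hv : 0 ≤ v)
    (hφ : ∀ t, HasDerivAt φ (φ' t) t) (h0 : φ 0 = 1)
    (h : ∀ t ∈ Set.Icc (0 : ℝ) 1, ‖φ' t + t * v * φ t‖ ≤ η) :
    ‖φ 1 - Real.exp (-v / 2)‖ ≤ η := by
  have hE : ∀ t : ℝ, HasDerivAt (fun t : ℝ => ((Real.exp (v * t ^ 2 / 2) : ℝ) : ℂ))
      ((Real.exp (v * t ^ 2 / 2) * (v * t) : ℝ) : ℂ) t := fun t => by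
    have : HasDerivAt (fun t : ℝ => v * t ^ 2 / 2) (v * t) t :=
      (((hasDerivAt_pow 2 t).const_mul v).div_const 2).congr_deriv (by norm_num; ring)
    exact this.exp.ofReal_comp
  have hη : 0 ≤ η := (norm_nonneg _).trans (h 0 (by simp))
  have key := norm_image_sub_le_of_norm_deriv_le_segment_01'
    (f := fun t => φ t * ((Real.exp (v * t ^ 2 / 2) : ℝ) : ℂ)) (C := η * Real.exp (v / 2))
    (fun t _ => ((hφ t).mul (hE t)).hasDerivWithinAt) (fun t ht => by
      have e : φ' t * ((Real.exp (v * t ^ 2 / 2) : ℝ) : ℂ) +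
          φ t * ((Real.exp (v * t ^ 2 / 2) * (v * t) : ℝ) : ℂ) =
          (φ' t + t * v * φ t) * ((Real.exp (v * t ^ 2 / 2) : ℝ) : ℂ) := by push_cast; ring
      rw [e, norm_mul, Complex.norm_real, Real.norm_eq_abs, Real.abs_exp]
      have ht1 : t ^ 2 ≤ 1 := pow_le_one₀ ht.1 ht.2.le
      gcongr
      · exact h t ⟨ht.1, ht.2.le⟩
      · nlinarith)
  simp only [one_pow, mul_one, h0, ne_eq, OfNat.ofNat_ne_zero, not_false_eq_true, zero_pow,
    mul_zero, zero_div, Real.exp_zero, Complex.ofReal_one] at key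
  have e : φ 1 - Real.exp (-v / 2) =
      (φ 1 * ((Real.exp (v / 2) : ℝ) : ℂ) - 1) * ((Real.exp (-v / 2) : ℝ) : ℂ) := by
    rw [sub_mul, mul_assoc, ← Complex.ofReal_mul, ← Real.exp_add]
    simp [neg_div]
  rw [e, norm_mul, Complex.norm_real, Real.norm_eq_abs, Real.abs_exp]
  calc _ ≤ η * Real.exp (v / 2) * Real.exp (-v / 2) := by gcongr
    _ = η := by rw [mul_assoc, ← Real.exp_add]; simp [neg_div]

section Array

variable {ι : Type*} [Fintype ι] [DecidableEq ι] {A : ι → ι → ℝ} {C : ℝ}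

lemma sum_sq_col_le (hA : ∀ x : ι → ℝ, ∑ i, (∑ j, A i j * x j) ^ 2 ≤ C ^ 2 * ∑ i, x i ^ 2)
    (j : ι) : ∑ i, A i j ^ 2 ≤ C ^ 2 := by
  simpa [Pi.single_apply] using hA (Pi.single j 1)

lemma abs_diag_le (hC : 0 ≤ C)
    (hA : ∀ x : ι → ℝ, ∑ i, (∑ j, A i j * x j) ^ 2 ≤ C ^ 2 * ∑ i, x i ^ 2) (j : ι) :
    |A j j| ≤ C := by
  apply abs_le_of_sq_le_sq _ hC
  exact (Finset.single_le_sum (f := fun i => A i j ^ 2) (fun i _ => sq_nonneg _)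
    (Finset.mem_univ j)).trans (sum_sq_col_le hA j)

lemma sum_offDiagPart_mul (A : ι → ι → ℝ) (x : ι → ℝ) (i : ι) :
    ∑ j, offDiagPart A i j * x j = ∑ j, A i j * x j - A i i * x i := by
  have : ∀ j, offDiagPart A i j * x j = A i j * x j - if i = j then A i j * x j else 0 := by
    intro j; by_cases h : i = j <;> simp [offDiagPart, h]
  simp [this, Finset.sum_sub_distrib]

lemma sum_offDiagPart_eq_erase (A : ι → ι → ℝ) (x : ι → ℝ) (i : ι) :
    ∑ j, offDiagPart A i j * x j = ∑ j ∈ Finset.univ.erase i, A i j * x j := by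
  rw [sum_offDiagPart_mul, ← Finset.add_sum_erase _ _ (Finset.mem_univ i)]
  ring

omit [Fintype ι] in
lemma offDiagPart_sq_le (A : ι → ι → ℝ) (i j : ι) : offDiagPart A i j ^ 2 ≤ A i j ^ 2 := by
  unfold offDiagPart; split_ifs <;> simp [sq_nonneg]

lemma sum_sq_offDiagPart_col_le
    (hA : ∀ x : ι → ℝ, ∑ i, (∑ j, A i j * x j) ^ 2 ≤ C ^ 2 * ∑ i, x i ^ 2)
    (j : ι) : ∑ i, offDiagPart A i j ^ 2 ≤ C ^ 2 :=
  (Finset.sum_le_sum fun i _ => offDiagPart_sq_le A i j).trans (sum_sq_col_le hA j)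

lemma offDiagPart_bound (hC : 0 ≤ C)
    (hA : ∀ x : ι → ℝ, ∑ i, (∑ j, A i j * x j) ^ 2 ≤ C ^ 2 * ∑ i, x i ^ 2) (x : ι → ℝ) :
    ∑ i, (∑ j, offDiagPart A i j * x j) ^ 2 ≤ 4 * C ^ 2 * ∑ i, x i ^ 2 := by
  simp only [sum_offDiagPart_mul]
  calc ∑ i, (∑ j, A i j * x j - A i i * x i) ^ 2
      ≤ ∑ i, (2 * (∑ j, A i j * x j) ^ 2 + 2 * (C ^ 2 * x i ^ 2)) := by
        refine Finset.sum_le_sum fun i _ => ?_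
        have h1 : A i i ^ 2 ≤ C ^ 2 := by
          rw [← sq_abs]; exact pow_le_pow_left₀ (abs_nonneg _) (abs_diag_le hC hA i) 2
        have h2 : A i i ^ 2 * x i ^ 2 ≤ C ^ 2 * x i ^ 2 := by gcongr
        nlinarith [sq_nonneg (∑ j, A i j * x j + A i i * x i)]
    _ = 2 * ∑ i, (∑ j, A i j * x j) ^ 2 + 2 * (C ^ 2 * ∑ i, x i ^ 2) := by
        simp only [Finset.sum_add_distrib, Finset.mul_sum]
    _ ≤ _ := by linarith [hA x]

omit [Fintype ι] in
lemma offDiagPart_symm (hs : ∀ i j, A i j = A j i) (i j : ι) :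
    offDiagPart A i j = offDiagPart A j i := by
  unfold offDiagPart; simp only [hs i j, eq_comm]

end Array

namespace IsStdFamily

variable {ι Ω : Type*} [Fintype ι] [DecidableEq ι] [MeasurableSpace Ω] {z : ι → Ω → ℝ}
  {P : Measure Ω} {m : ℝ} [IsProbabilityMeasure P] {A : ι → ι → ℝ} {C : ℝ}

/-- Fluctuations of the sum of the conditional variances. -/
lemma integral_abs_lin_add_quad_le (hz : IsStdFamily z P m) (hm : 1 ≤ m) (hC : 0 ≤ C)
    (hs : ∀ i j, A i j = A j i)
    (hA : ∀ x : ι → ℝ, ∑ i, (∑ j, A i j * x j) ^ 2 ≤ C ^ 2 * ∑ i, x i ^ 2)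
    {g : ι → ℝ} (hg : ∀ i, |g i| ≤ C * m) :
    Integrable (fun ω => 3 * ∑ k, g k * (∑ j, offDiagPart A k j * z j ω) +
      2 * ∑ k, ((∑ j, offDiagPart A k j * z j ω) ^ 2 - ∑ j, offDiagPart A k j ^ 2)) P ∧
    ∫ ω, |3 * ∑ k, g k * (∑ j, offDiagPart A k j * z j ω) +
      2 * ∑ k, ((∑ j, offDiagPart A k j * z j ω) ^ 2 - ∑ j, offDiagPart A k j ^ 2)| ∂P ≤
      12 * √(Fintype.card ι) * C ^ 2 * m := by
  set O := offDiagPart A with hO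
  have hOs : ∀ i j, O i j = O j i := offDiagPart_symm hs
  -- The linear part has coefficient vector Og and the quadratic part has matrix O². The operator
  -- bound on O then makes both sums of squares linear in n, and so the L² norm of order √n.
  set b : ι → ℝ := fun j => ∑ k, O j k * g k with hb
  set M : ι → ι → ℝ := fun i j => ∑ k, O j k * O k i with hM
  have hMs : ∀ i j, M i j = M j i := fun i j => Finset.sum_congr rfl fun k _ => by
    rw [hOs j k, hOs k i, mul_comm]
  have e1 : ∀ ω, ∑ k, g k * (∑ j, O k j * z j ω) = ∑ j, b j * z j ω := fun ω => by
    simp only [hb, Finset.mul_sum, Finset.sum_mul]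
    rw [Finset.sum_comm]
    exact Finset.sum_congr rfl fun j _ => Finset.sum_congr rfl fun k _ => by rw [hOs k j]; ring
  have e2 : ∀ ω, ∑ k, ((∑ j, O k j * z j ω) ^ 2 - ∑ j, O k j ^ 2) =
      ∑ i, ∑ j, M i j * (z i ω * z j ω) - ∑ i, M i i := fun ω => by
    rw [Finset.sum_sub_distrib]
    congr 1
    · simp only [hM, pow_two, Finset.sum_mul, Finset.mul_sum]
      rw [Finset.sum_comm]
      refine Finset.sum_congr rfl fun i _ => ?_
      rw [Finset.sum_comm]
      refine Finset.sum_congr rfl fun j _ => Finset.sum_congr rfl fun k _ => ?_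
      rw [hOs j k]; ring
    · rw [Finset.sum_comm]
      exact Finset.sum_congr rfl fun i _ => Finset.sum_congr rfl fun k _ => by rw [hOs i k, pow_two]
  simp only [e1, e2]
  set n : ℝ := ((Fintype.card ι : ℕ) : ℝ) with hn
  have hlin := hz.hasMean_lin_sq Finset.univ b
  have hquad := hz.integral_quad_sq_le Finset.univ M hMs
  have hqL := hz.memLp_quad Finset.univ M (∑ i, M i i)
  have hlL : MemLp (fun ω => ∑ j, b j * z j ω) 2 P :=
    (hz.memLp_lin Finset.univ b).mono_exponent (by norm_num)
  have hb2 : ∑ j, b j ^ 2 ≤ 4 * n * C ^ 4 * m ^ 2 := by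
    refine (offDiagPart_bound hC hA g).trans ?_
    have : ∑ i, g i ^ 2 ≤ ∑ _i : ι, (C * m) ^ 2 := Finset.sum_le_sum fun i _ => by
      rw [← sq_abs]; exact pow_le_pow_left₀ (abs_nonneg _) (hg i) 2
    rw [Finset.sum_const, nsmul_eq_mul, Finset.card_univ, ← hn] at this
    calc 4 * C ^ 2 * ∑ i, g i ^ 2 ≤ 4 * C ^ 2 * (n * (C * m) ^ 2) := by gcongr
      _ = _ := by ring
  have hM2 : ∑ i, ∑ j, M i j ^ 2 ≤ 4 * n * C ^ 4 := by
    have : ∀ i, ∑ j, M i j ^ 2 ≤ 4 * C ^ 4 := fun i => by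
      refine (offDiagPart_bound hC hA (fun k => O k i)).trans ?_
      calc _ ≤ 4 * C ^ 2 * C ^ 2 := by gcongr; exact sum_sq_offDiagPart_col_le hA i
        _ = _ := by ring
    calc _ ≤ ∑ _i : ι, 4 * C ^ 4 := Finset.sum_le_sum fun i _ => this i
      _ = _ := by rw [Finset.sum_const, nsmul_eq_mul, Finset.card_univ, ← hn]; ring
  set F : Ω → ℝ := fun ω => 3 * ∑ j, b j * z j ω +
    2 * (∑ i, ∑ j, M i j * (z i ω * z j ω) - ∑ i, M i i) with hF
  have hFL : MemLp F 2 P := (hlL.const_mul 3).add (hqL.const_mul 2)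
  refine ⟨hFL.integrable (by norm_num), ?_⟩
  have hF2 : ∫ ω, F ω ^ 2 ∂P ≤ (12 * √n * C ^ 2 * m) ^ 2 := by
    have hn0 : 0 ≤ n := by positivity
    -- The weights 18 = 2·3² and 8 = 2·2² lead to 18·4 + 8·2·4 = 136, below 144 = 12².
    have := HasMean.mono (⟨hFL.integrable_sq, rfl⟩ : HasMean P (fun ω => F ω ^ 2) _)
      ((hlin.const_mul 18).add ((⟨hqL.integrable_sq, rfl⟩ : HasMean P (fun ω =>
      (∑ i, ∑ j, M i j * (z i ω * z j ω) - ∑ i, M i i) ^ 2) _).const_mul 8)) fun ω => by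
        refine (add_sq_le (a := 3 * ∑ j, b j * z j ω)).trans ?_
        linarith
    refine this.trans ?_
    have h1 : 2 * m * ∑ i, ∑ j, M i j ^ 2 ≤ 2 * m * (4 * n * C ^ 4) := by gcongr
    have h2 : m * (n * C ^ 4) ≤ m ^ 2 * (n * C ^ 4) := by gcongr; nlinarith
    have h3 : (12 * √n * C ^ 2 * m) ^ 2 = 144 * n * C ^ 4 * m ^ 2 := by
      rw [mul_pow, mul_pow, mul_pow, Real.sq_sqrt hn0]; ring
    rw [h3]
    nlinarith
  -- Jensen's inequality, read off from the non-negativity of the variance of |F|.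
  have hvar : (∫ ω, |F ω| ∂P) ^ 2 ≤ ∫ ω, F ω ^ 2 ∂P := by
    have h := variance_nonneg (fun ω => |F ω|) P
    rw [variance_eq_sub (X := fun ω => |F ω|) hFL.abs] at h
    simp only [Pi.pow_apply, sq_abs] at h
    linarith
  exact (le_abs_self _).trans (abs_le_of_sq_le_sq (hvar.trans hF2) (by positivity))

end IsStdFamily

/-! ### Central limit estimate for deterministic coefficients -/

/-- The centred quadratic form of the array `A` at the vector `x`. -/
def centredQuad {ι : Type*} [Fintype ι] (A : ι → ι → ℝ) (x : ι → ℝ) : ℝ :=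
  ∑ i, ∑ j, A i j * (x i * x j) - ∑ i, A i i

/-- The variance of the centred quadratic form of a symmetric array `A` in independent standardized
variables with fourth moments `μ₄`. -/
def quadVar {ι : Type*} [Fintype ι] [DecidableEq ι] (μ₄ : ι → ℝ) (A : ι → ι → ℝ) : ℝ :=
  ∑ k, (A k k ^ 2 * (μ₄ k - 1) + 2 * ∑ j, offDiagPart A k j ^ 2)

section

variable {ι : Type*} [Fintype ι]

lemma measurable_centredQuad (A : ι → ι → ℝ) : Measurable (centredQuad A) := by
  unfold centredQuad; fun_prop

variable [DecidableEq ι]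

/-- By symmetry the cross term with x_k occurs in row k and in column k, hence the factor 2. In the
row decomposition `centredQuad_eq_sum` it is counted once per row. -/
lemma centredQuad_eq_update {A : ι → ι → ℝ} (hs : ∀ i j, A i j = A j i) (x : ι → ℝ) (k : ι) :
    centredQuad A x = (∑ i ∈ Finset.univ.erase k, ∑ j ∈ Finset.univ.erase k, A i j * (x i * x j) -
      ∑ i ∈ Finset.univ.erase k, A i i) +
      (A k k * (x k ^ 2 - 1) + 2 * x k * ∑ j, offDiagPart A k j * x j) := by
  have h1 : ∑ i ∈ Finset.univ.erase k, A i k * (x i * x k) =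
      x k * ∑ j, offDiagPart A k j * x j := by
    rw [sum_offDiagPart_eq_erase, Finset.mul_sum]
    exact Finset.sum_congr rfl fun i _ => by rw [hs i k]; ring
  have h2 : ∑ j ∈ Finset.univ.erase k, A k j * (x k * x j) =
      x k * ∑ j, offDiagPart A k j * x j := by
    rw [sum_offDiagPart_eq_erase, Finset.mul_sum]
    exact Finset.sum_congr rfl fun i _ => by ring
  unfold centredQuad
  rw [← Finset.add_sum_erase _ (fun i => A i i) (Finset.mem_univ k),
    ← Finset.add_sum_erase _ _ (Finset.mem_univ k)]
  have h3 : ∀ i, ∑ j, A i j * (x i * x j) = A i k * (x i * x k) +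
      ∑ j ∈ Finset.univ.erase k, A i j * (x i * x j) := fun i =>
    (Finset.add_sum_erase _ _ (Finset.mem_univ k)).symm
  simp only [h3, Finset.sum_add_distrib, h1, h2]
  ring

lemma centredQuad_eq_sum (A : ι → ι → ℝ) (x : ι → ℝ) :
    centredQuad A x = ∑ k, (A k k * (x k ^ 2 - 1) + x k * ∑ j, offDiagPart A k j * x j) := by
  unfold centredQuad
  rw [← Finset.sum_sub_distrib]
  refine Finset.sum_congr rfl fun k _ => ?_
  have : ∑ j, A k j * (x k * x j) = x k * ∑ j, A k j * x j := by
    rw [Finset.mul_sum]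
    exact Finset.sum_congr rfl fun j _ => by ring
  rw [sum_offDiagPart_mul, this]
  ring

end

namespace IsStdFamily

variable {ι Ω : Type*} [Fintype ι] [DecidableEq ι] [MeasurableSpace Ω] {z : ι → Ω → ℝ}
  {P : Measure Ω} {m : ℝ} [IsProbabilityMeasure P] {A : ι → ι → ℝ} {C : ℝ}

lemma quadVar_nonneg (hz : IsStdFamily z P m) :
    0 ≤ quadVar (fun k => ∫ ω, z k ω ^ 4 ∂P) A :=
  Finset.sum_nonneg fun k _ => add_nonneg
    (mul_nonneg (sq_nonneg _) (sub_nonneg.2 (hz.one_le_four k)))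
    (mul_nonneg zero_le_two (Finset.sum_nonneg fun _ _ => sq_nonneg _))

/-- The leave-one-out estimate for the `k`-th variable of a quadratic form. -/
lemma norm_integral_site_le (hz : IsStdFamily z P m) (hC : 1 ≤ C)
    (hs : ∀ i j, A i j = A j i)
    (hA : ∀ x : ι → ℝ, ∑ i, (∑ j, A i j * x j) ^ 2 ≤ C ^ 2 * ∑ i, x i ^ 2)
    {s ε τ : ℝ} (hs0 : 0 < s) (hε : 0 ≤ ε) (hτ : |τ| ≤ 1 / s) (k : ι) :
    ‖∫ ω, (((A k k * (z k ω ^ 2 - 1) + z k ω * ∑ j, offDiagPart A k j * z j ω : ℝ) : ℂ) -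
        τ * Complex.I * ((A k k ^ 2 * ((∫ ω, z k ω ^ 4 ∂P) - 1) +
          3 * A k k * (∫ ω, z k ω ^ 3 ∂P) * (∑ j, offDiagPart A k j * z j ω) +
          2 * (∑ j, offDiagPart A k j * z j ω) ^ 2 : ℝ) : ℂ)) *
        Complex.exp ((τ * centredQuad A (fun i => z i ω) : ℝ) * Complex.I) ∂P‖ ≤
      500 * C ^ 4 * m ^ 2 * (1 / s ^ 2) + (1 / s) * (16 * C ^ 3 * ε * m + 8 * C ^ 2 *
        ∫ ω in {ω | ε * s < |(|z k ω| ^ 2 - 1)|}, |(|z k ω| ^ 2 - 1)| ^ 2 ∂P) := by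
  set T := Finset.univ.erase k with hT
  have hk : k ∉ T := Finset.notMem_erase _ _
  set h : Ω → ℝ := fun ω => ∑ j, offDiagPart A k j * z j ω with hh
  have hhT : ∀ ω, h ω = ∑ j ∈ T, A k j * z j ω := fun ω => sum_offDiagPart_eq_erase A _ k
  set q : Ω → ℝ := fun ω => ∑ i ∈ T, ∑ j ∈ T, A i j * (z i ω * z j ω) - ∑ i ∈ T, A i i with hq
  set e : Ω → ℂ := fun ω => Complex.exp ((τ * q ω : ℝ) * Complex.I) with he
  have hzm := hz.meas
  have hind : IndepFun (z k) (fun ω => (h ω, e ω)) P := by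
    have := (hz.indepFun_quad_lin hk (A k) A (∑ i ∈ T, A i i)).comp (φ := id)
      (ψ := fun p : ℝ × ℝ => (p.2, Complex.exp ((τ * p.1 : ℝ) * Complex.I)))
      measurable_id (by fun_prop)
    rw [funext hhT]
    exact this
  have hsum : ∑ j, offDiagPart A k j ^ 2 ≤ C ^ 2 := by
    simpa only [offDiagPart_symm hs] using sum_sq_offDiagPart_col_le hA k
  have hsum0 : 0 ≤ ∑ j, offDiagPart A k j ^ 2 := Finset.sum_nonneg fun _ _ => sq_nonneg _
  have hm := hz.one_le k
  have := norm_integral_leave_one_out_le (a := A k k) (m := m) (C := C) (τ := τ) (s := s) (ε := ε)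
    hind (hz.meas k) (by fun_prop) (by fun_prop) (hz.memLp k) (hz.memLp_lin _ _)
    (fun ω => by rw [he]; exact Complex.norm_exp_ofReal_mul_I _) (hz.mean k) (hz.sq k)
    (hz.abs_third_le k) (hz.four k) (hz.one_le_four k)
    ((hz.hasMean_lin_sq _ _).eq.trans_le hsum)
    ((hz.integral_lin_four_le _ _).trans (by
      calc _ ≤ 3 * m * (C ^ 2) ^ 2 := by gcongr
        _ = _ := by ring))
    hC (abs_diag_le (by linarith) hA k) hs0 hτ hε
  convert this using 5 with ω
  rw [he, ← Complex.exp_add, ← add_mul, ← Complex.ofReal_add,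
    centredQuad_eq_update hs (fun i => z i ω) k, ← mul_add]

/-- The estimate driving the differential equation for the characteristic function of a quadratic
form. -/
lemma norm_deriv_add_le (hz : IsStdFamily z P m) (hm : 1 ≤ m) (hC : 1 ≤ C)
    (hs : ∀ i j, A i j = A j i)
    (hA : ∀ x : ι → ℝ, ∑ i, (∑ j, A i j * x j) ^ 2 ≤ C ^ 2 * ∑ i, x i ^ 2)
    {s ε R t : ℝ} (hs0 : 0 < s) (hε : 0 ≤ ε) (hR : 1 ≤ R) (hn : Fintype.card ι ≤ R * s ^ 2)
    (ht : |t| ≤ 1) :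
    ‖(∫ ω, ((1 / s * centredQuad A (fun i => z i ω) : ℝ) : ℂ) * Complex.I *
        Complex.exp ((t * (1 / s * centredQuad A (fun i => z i ω)) : ℝ) * Complex.I) ∂P) +
      t * ((1 / s ^ 2 * quadVar (fun k => ∫ ω, z k ω ^ 4 ∂P) A : ℝ) : ℂ) *
      ∫ ω, Complex.exp ((t * (1 / s * centredQuad A (fun i => z i ω)) : ℝ) * Complex.I) ∂P‖ ≤
      512 * R * C ^ 4 * m ^ 2 * (1 / s) + 16 * R * C ^ 3 * m * ε + 8 * C ^ 2 * ((1 / s ^ 2) *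
        ∑ k, ∫ ω in {ω | ε * s < |(|z k ω| ^ 2 - 1)|}, |(|z k ω| ^ 2 - 1)| ^ 2 ∂P) := by
  set n : ℝ := ((Fintype.card ι : ℕ) : ℝ) with hndef
  set τ := t / s with hτdef
  have hτ : |τ| ≤ 1 / s := by
    rw [hτdef, abs_div, abs_of_pos hs0]; gcongr
  set h : ι → Ω → ℝ := fun k ω => ∑ j, offDiagPart A k j * z j ω with hh
  set Q : Ω → ℝ := fun ω => centredQuad A (fun i => z i ω) with hQ
  set E : Ω → ℂ := fun ω => Complex.exp ((τ * Q ω : ℝ) * Complex.I) with hE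
  have hE' : ∀ ω, Complex.exp ((t * (1 / s * Q ω) : ℝ) * Complex.I) = E ω := fun ω => by
    simp only [hE, hτdef]; congr 3; ring
  simp only [show ∀ ω, centredQuad A (fun i => z i ω) = Q ω from fun _ => rfl, hE']
  set μ₃ : ι → ℝ := fun k => ∫ ω, z k ω ^ 3 ∂P
  set μ₄ : ι → ℝ := fun k => ∫ ω, z k ω ^ 4 ∂P
  set U : ι → Ω → ℝ := fun k ω => A k k * (z k ω ^ 2 - 1) + z k ω * h k ω with hU
  set c : ι → Ω → ℝ := fun k ω => A k k ^ 2 * (μ₄ k - 1) + 3 * A k k * μ₃ k * h k ω +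
    2 * h k ω ^ 2 with hc
  set ℓ : ι → ℝ := fun k =>
    ∫ ω in {ω | ε * s < |(|z k ω| ^ 2 - 1)|}, |(|z k ω| ^ 2 - 1)| ^ 2 ∂P with hℓ
  have hzm := hz.meas
  have hQm : Measurable Q := (measurable_centredQuad A).comp (measurable_pi_lambda _ hzm)
  have hEm : Measurable E := by fun_prop
  have hEn : ∀ ω, ‖E ω‖ = 1 := fun ω => Complex.norm_exp_ofReal_mul_I _
  have hEi : Integrable E P :=
    (integrable_const (1 : ℝ)).mono' hEm.aestronglyMeasurable (.of_forall fun ω => (hEn ω).le)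
  -- integrability
  have hUi : ∀ k, Integrable (U k) P := fun k => by
    refine (((hz.hasMean_sq k).sub (.const 1)).const_mul (A k k)).1.add ?_
    exact ((hz.memLp k).mono_exponent (by norm_num)).integrable_mul (p := 2) (q := 2)
      ((hz.memLp_lin _ _).mono_exponent (by norm_num))
  have hci : ∀ k, Integrable (c k) P := fun k =>
    ((integrable_const _).add ((hz.hasMean_lin Finset.univ (offDiagPart A k)).1.const_mul _)).add
      ((hz.hasMean_lin_sq Finset.univ (offDiagPart A k)).1.const_mul 2)
  have hmulE : ∀ {f : Ω → ℂ}, Integrable f P → Integrable (fun ω => f ω * E ω) P := fun hf =>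
    hf.mul_bdd (c := 1) hEm.aestronglyMeasurable (.of_forall fun ω => (hEn ω).le)
  -- the decomposition
  set S : Ω → ℝ := fun ω => 3 * ∑ k, (A k k * μ₃ k) * h k ω +
    2 * ∑ k, (h k ω ^ 2 - ∑ j, offDiagPart A k j ^ 2) with hS
  obtain ⟨hSi, hSle⟩ := hz.integral_abs_lin_add_quad_le hm (by linarith) hs hA
    (g := fun k => A k k * μ₃ k) (fun k => by
      rw [abs_mul]
      exact mul_le_mul (abs_diag_le (by linarith) hA k) (hz.abs_third_le k) (abs_nonneg _)
        (by linarith))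
  have hsumc : ∀ ω, ∑ k, c k ω = quadVar μ₄ A + S ω := fun ω => by
    simp only [hc, hS, quadVar, Finset.sum_add_distrib, Finset.sum_sub_distrib, Finset.mul_sum]
    rw [mul_sub]
    simp only [Finset.mul_sum, mul_assoc]
    ring
  have hGi : ∀ k, Integrable (fun ω => ((U k ω : ℂ) - τ * Complex.I * (c k ω : ℂ)) * E ω) P :=
    fun k => hmulE ((hUi k).ofReal.sub ((hci k).ofReal.const_mul _))
  have hsC : (s : ℂ) ≠ 0 := by exact_mod_cast hs0.ne'
  -- Since τ = t/s, the terms -iτ c_k multiplied by i/s add up to (t/s²)(variance + S). The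
  -- fluctuation S is therefore removed separately.
  have hpt : ∀ ω, ((1 / s * Q ω : ℝ) : ℂ) * Complex.I * E ω +
      t * ((1 / s ^ 2 * quadVar μ₄ A : ℝ) : ℂ) * E ω =
      (Complex.I / s) * ∑ k, ((U k ω : ℂ) - τ * Complex.I * (c k ω : ℂ)) * E ω -
        ((t / s ^ 2 : ℝ) : ℂ) * ((S ω : ℂ) * E ω) := fun ω => by
    rw [← Finset.sum_mul, Finset.sum_sub_distrib, ← Finset.mul_sum, ← Complex.ofReal_sum,
      ← Complex.ofReal_sum, hsumc, ← centredQuad_eq_sum A (fun i => z i ω)]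
    simp only [hτdef, hQ]
    push_cast
    field_simp
    ring_nf
    simp only [Complex.I_sq]
    ring
  have hQi : Integrable Q P := by
    have : Q = fun ω => ∑ k, U k ω := funext fun ω => centredQuad_eq_sum A _
    rw [this]
    exact integrable_finsetSum _ fun k _ => hUi k
  have key : (∫ ω, ((1 / s * Q ω : ℝ) : ℂ) * Complex.I * E ω ∂P) +
      t * ((1 / s ^ 2 * quadVar μ₄ A : ℝ) : ℂ) * ∫ ω, E ω ∂P =
      (Complex.I / s) * ∑ k, ∫ ω, ((U k ω : ℂ) - τ * Complex.I * (c k ω : ℂ)) * E ω ∂P -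
        ((t / s ^ 2 : ℝ) : ℂ) * ∫ ω, (S ω : ℂ) * E ω ∂P := by
    have l1 : HasMean P (fun ω => ((1 / s * Q ω : ℝ) : ℂ) * Complex.I * E ω) _ :=
      ⟨hmulE ((hQi.const_mul (1 / s)).ofReal.mul_const Complex.I), rfl⟩
    have l2 := l1.add ((⟨hEi, rfl⟩ : HasMean P E _).const_mul
      (t * ((1 / s ^ 2 * quadVar μ₄ A : ℝ) : ℂ)))
    have r1 := ((HasMean.sum Finset.univ fun k _ => ⟨hGi k, rfl⟩).const_mul (Complex.I / s)).sub
      ((⟨hmulE hSi.ofReal, rfl⟩ : HasMean P (fun ω => (S ω : ℂ) * E ω) _).const_mul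
        ((t / s ^ 2 : ℝ) : ℂ))
    exact l2.2.symm.trans ((integral_congr_ae (.of_forall hpt)).trans r1.2)
  rw [key]
  refine (norm_sub_le _ _).trans ?_
  have b1 : ‖(Complex.I / s) * ∑ k, ∫ ω, ((U k ω : ℂ) - τ * Complex.I * (c k ω : ℂ)) * E ω ∂P‖ ≤
      (1 / s) * ∑ k, (500 * C ^ 4 * m ^ 2 * (1 / s ^ 2) +
        (1 / s) * (16 * C ^ 3 * ε * m + 8 * C ^ 2 * ℓ k)) := by
    rw [norm_mul, norm_div, Complex.norm_I, Complex.norm_real, Real.norm_eq_abs, abs_of_pos hs0]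
    gcongr
    refine (norm_sum_le _ _).trans (Finset.sum_le_sum fun k _ => ?_)
    exact hz.norm_integral_site_le hC hs hA hs0 hε hτ k
  have b2 : ‖((t / s ^ 2 : ℝ) : ℂ) * ∫ ω, (S ω : ℂ) * E ω ∂P‖ ≤
      (1 / s ^ 2) * (12 * √n * C ^ 2 * m) := by
    rw [norm_mul, Complex.norm_real, Real.norm_eq_abs, abs_div, abs_of_pos (by positivity :
      0 < s ^ 2)]
    gcongr
    refine le_trans ?_ hSle
    refine norm_integral_le_of_norm_le hSi.abs (.of_forall fun ω => ?_)
    rw [norm_mul, hEn, mul_one, Complex.norm_real, Real.norm_eq_abs]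
  refine (add_le_add b1 b2).trans ?_
  have hsq : √n ≤ R * s := by
    rw [show R * s = √((R * s) ^ 2) from (Real.sqrt_sq (by positivity)).symm]
    apply Real.sqrt_le_sqrt
    calc n ≤ R * s ^ 2 := hn
      _ ≤ R ^ 2 * s ^ 2 := by gcongr; nlinarith
      _ = _ := by ring
  have hns : n * (1 / s ^ 2) ≤ R := by
    rw [mul_one_div, div_le_iff₀ (by positivity)]; exact hn
  have hcm : C ^ 2 * m ≤ C ^ 4 * m ^ 2 := by
    gcongr
    · norm_num
    · nlinarith
  rw [Finset.sum_add_distrib, Finset.sum_const, ← Finset.mul_sum, Finset.sum_add_distrib,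
    Finset.sum_const, ← Finset.mul_sum, nsmul_eq_mul, nsmul_eq_mul, Finset.card_univ, ← hndef]
  -- The final 512 is 500 from the single-variable errors plus 12 from the fluctuation S.
  have d1 : (1 / s) * (n * (500 * C ^ 4 * m ^ 2 * (1 / s ^ 2))) ≤
      500 * R * C ^ 4 * m ^ 2 * (1 / s) := by
    calc _ = (500 * C ^ 4 * m ^ 2 * (1 / s)) * (n * (1 / s ^ 2)) := by ring
      _ ≤ (500 * C ^ 4 * m ^ 2 * (1 / s)) * R := by gcongr
      _ = _ := by ring
  have d2 : (1 / s) * ((1 / s) * (n * (16 * C ^ 3 * ε * m))) ≤ 16 * R * C ^ 3 * m * ε := by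
    calc _ = (16 * C ^ 3 * ε * m) * (n * (1 / s ^ 2)) := by ring
      _ ≤ (16 * C ^ 3 * ε * m) * R := by gcongr
      _ = _ := by ring
  have d3 : (1 / s ^ 2) * (12 * √n * C ^ 2 * m) ≤ 12 * R * C ^ 4 * m ^ 2 * (1 / s) := by
    calc _ = (1 / s ^ 2) * (12 * √n * (C ^ 2 * m)) := by ring
      _ ≤ (1 / s ^ 2) * (12 * (R * s) * (C ^ 4 * m ^ 2)) := by gcongr
      _ = _ := by field_simp
  have d4 : (1 / s) * ((1 / s) * (8 * C ^ 2 * ∑ k, ℓ k)) = 8 * C ^ 2 * ((1 / s ^ 2) * ∑ k, ℓ k) := by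
    ring
  linarith [d1, d2, d3, d4.le]

/-- Quantitative central limit theorem for a quadratic form in independent variables. -/
theorem norm_integral_exp_centredQuad_sub_le (hz : IsStdFamily z P m) (hm : 1 ≤ m) (hC : 1 ≤ C)
    (hs : ∀ i j, A i j = A j i)
    (hA : ∀ x : ι → ℝ, ∑ i, (∑ j, A i j * x j) ^ 2 ≤ C ^ 2 * ∑ i, x i ^ 2)
    {s ε R : ℝ} (hs0 : 0 < s) (hε : 0 ≤ ε) (hR : 1 ≤ R) (hn : Fintype.card ι ≤ R * s ^ 2) :
    ‖(∫ ω, Complex.exp ((1 / s * centredQuad A (fun i => z i ω) : ℝ) * Complex.I) ∂P) -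
      Real.exp (-(1 / s ^ 2 * quadVar (fun k => ∫ ω, z k ω ^ 4 ∂P) A) / 2)‖ ≤
      512 * R * C ^ 4 * m ^ 2 * (1 / s) + 16 * R * C ^ 3 * m * ε + 8 * C ^ 2 * ((1 / s ^ 2) *
        ∑ k, ∫ ω in {ω | ε * s < |(|z k ω| ^ 2 - 1)|}, |(|z k ω| ^ 2 - 1)| ^ 2 ∂P) := by
  set X : Ω → ℝ := fun ω => 1 / s * centredQuad A (fun i => z i ω) with hX
  have hXi : Integrable X P := by
    refine Integrable.const_mul ?_ _
    exact ((hz.memLp_quad Finset.univ A (∑ i, A i i)).integrable (by norm_num))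
  have hXm : AEStronglyMeasurable X P := hXi.aestronglyMeasurable
  have hmeas : ∀ t : ℝ, AEStronglyMeasurable (fun ω => Complex.exp ((t * X ω : ℝ) * Complex.I)) P :=
    fun t => (by fun_prop : Continuous fun x : ℝ =>
      Complex.exp ((t * x : ℝ) * Complex.I)).comp_aestronglyMeasurable hXm
  have hd : ∀ t : ℝ, HasDerivAt (fun t : ℝ => ∫ ω, Complex.exp ((t * X ω : ℝ) * Complex.I) ∂P)
      (∫ ω, (X ω : ℂ) * Complex.I * Complex.exp ((t * X ω : ℝ) * Complex.I) ∂P) t := fun t => by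
    refine (hasDerivAt_integral_of_dominated_loc_of_deriv_le (bound := fun ω => |X ω|)
      (F' := fun t ω => (X ω : ℂ) * Complex.I * Complex.exp ((t * X ω : ℝ) * Complex.I))
      (s := Set.univ) Filter.univ_mem (.of_forall fun t => hmeas t) ?_ ?_ ?_ hXi.abs ?_).2
    · exact (integrable_const (1 : ℝ)).mono' (hmeas t)
        (.of_forall fun ω => (Complex.norm_exp_ofReal_mul_I _).le)
    · exact (hXi.ofReal.aestronglyMeasurable.mul_const _).mul (hmeas t)
    · refine .of_forall fun ω t _ => ?_
      rw [norm_mul, Complex.norm_exp_ofReal_mul_I, norm_mul, Complex.norm_I, Complex.norm_real]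
      simp
    · refine .of_forall fun ω t _ => ?_
      have h1 : HasDerivAt (fun t : ℝ => ((t * X ω : ℝ) : ℂ) * Complex.I)
          ((X ω : ℂ) * Complex.I) t := by
        have := (((hasDerivAt_id t).mul_const (X ω)).ofReal_comp).mul_const Complex.I
        simpa using this
      exact h1.cexp.congr_deriv (by ring)
  have := norm_sub_exp_neg_le_of_deriv (mul_nonneg (by positivity : 0 ≤ 1 / s ^ 2) hz.quadVar_nonneg)
    hd (by simp) fun t ht => hz.norm_deriv_add_le hm hC hs hA hs0 hε hR hn
      (abs_le.2 ⟨by linarith [ht.1], ht.2⟩)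
  simpa only [one_mul] using this

end IsStdFamily

/-! ### Convergence in probability to a constant -/

section InProb

variable {Ω : ℕ → Type*} [∀ N, MeasurableSpace (Ω N)] {P : ∀ N, Measure (Ω N)}
  {X Y : ∀ N, Ω N → ℝ} {c d : ℝ}

lemma TendstoInProbConst.of_le (hX : TendstoInProbConst P X c)
    (hXY : ∀ ε > 0, ∃ δ > 0, ∀ N, ∀ᵐ ω ∂(P N), ε ≤ |Y N ω - d| → δ ≤ |X N ω - c|) :
    TendstoInProbConst P Y d := by
  intro ε hε
  obtain ⟨δ, hδ, h⟩ := hXY ε hε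
  exact tendsto_of_tendsto_of_tendsto_of_le_of_le tendsto_const_nhds (hX δ hδ)
    (fun _ => zero_le) fun N => measure_mono_ae (h N)

lemma TendstoInProbConst.congr (hX : TendstoInProbConst P X c)
    (h : ∀ N, ∀ᵐ ω ∂(P N), Y N ω = X N ω) : TendstoInProbConst P Y c :=
  hX.of_le fun ε hε => ⟨ε, hε, fun N => (h N).mono fun ω hω => by rw [hω]; exact id⟩

lemma TendstoInProbConst.const_mul (hX : TendstoInProbConst P X c) (k : ℝ) :
    TendstoInProbConst P (fun N ω => k * X N ω) (k * c) := by
  refine hX.of_le fun ε hε => ⟨ε / (|k| + 1), by positivity, fun N => .of_forall fun ω h => ?_⟩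
  rw [← mul_sub, abs_mul] at h
  rw [div_le_iff₀ (by positivity)]
  nlinarith [abs_nonneg (X N ω - c)]

lemma TendstoInProbConst.add (hX : TendstoInProbConst P X c) (hY : TendstoInProbConst P Y d) :
    TendstoInProbConst P (fun N ω => X N ω + Y N ω) (c + d) := by
  intro ε hε
  have h := (hX (ε / 2) (by positivity)).add (hY (ε / 2) (by positivity))
  rw [add_zero] at h
  refine tendsto_of_tendsto_of_tendsto_of_le_of_le tendsto_const_nhds h
    (fun _ => zero_le) fun N => (measure_mono fun ω hω => ?_).trans (measure_union_le _ _)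
  by_contra hcon
  simp only [Set.mem_union, Set.mem_ofPred_eq, not_or, not_le] at hcon hω
  have : |X N ω + Y N ω - (c + d)| ≤ |X N ω - c| + |Y N ω - d| := by
    rw [show X N ω + Y N ω - (c + d) = (X N ω - c) + (Y N ω - d) by ring]
    exact abs_add_le _ _
  linarith

lemma TendstoInProbConst.sum {κ : Type*} (s : Finset κ) {X : κ → ∀ N, Ω N → ℝ} {c : κ → ℝ}
    (h : ∀ i ∈ s, TendstoInProbConst P (X i) (c i)) :
    TendstoInProbConst P (fun N ω => ∑ i ∈ s, X i N ω) (∑ i ∈ s, c i) := by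
  classical
  induction s using Finset.induction_on with
  | empty =>
    intro ε hε
    simp [not_le.2 hε]
  | insert k s hk ih =>
    simp only [Finset.sum_insert hk]
    exact (h k (by simp)).add (ih fun i hi => h i (by simp [hi]))

variable [∀ N, IsProbabilityMeasure (P N)]

lemma TendstoInProbConst.unique (hX : TendstoInProbConst P X c) (hY : TendstoInProbConst P X d) :
    c = d := by
  by_contra hcd
  have h := (hX.const_mul (-1)).add hY
  have := h (|c - d|) (abs_pos.2 (sub_ne_zero.2 hcd))
  have h2 : ∀ N (ω : Ω N), -1 * X N ω + X N ω - (-1 * c + d) = c - d := fun N ω => by ring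
  simp only [h2, le_refl, Set.ofPred_true, measure_univ] at this
  exact one_ne_zero (tendsto_nhds_unique tendsto_const_nhds this)

lemma TendstoInProbConst.nonneg (hX : TendstoInProbConst P X c)
    (h : ∀ N, ∀ᵐ ω ∂(P N), 0 ≤ X N ω) : 0 ≤ c := by
  by_contra! hc
  have h1 := hX (-c) (by linarith)
  have h2 : ∀ N, P N {ω | -c ≤ |X N ω - c|} = 1 := fun N => by
    rw [measure_congr (eventuallyEq_univ.2 ?_), measure_univ]
    filter_upwards [h N] with ω hω
    rw [abs_of_nonneg (by linarith)]
    linarith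
  simp only [h2] at h1
  exact one_ne_zero (tendsto_nhds_unique tendsto_const_nhds h1)

/-- The bound 1 serves on the event of a large deviation, the Lipschitz bound off it. -/
lemma abs_exp_neg_half_sub_le {x y : ℝ} (hx : 0 ≤ x) (hy : 0 ≤ y) :
    |Real.exp (-x / 2) - Real.exp (-y / 2)| ≤ min 1 |x - y| := by
  have key : ∀ {x y : ℝ}, 0 ≤ x → x ≤ y →
      |Real.exp (-x / 2) - Real.exp (-y / 2)| ≤ min 1 |x - y| := by
    intro x y hx hxy
    have h1 : Real.exp (-y / 2) ≤ Real.exp (-x / 2) := Real.exp_le_exp.2 (by linarith)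
    have h2 : Real.exp (-x / 2) ≤ 1 := Real.exp_le_one_iff.2 (by linarith)
    rw [abs_of_nonneg (by linarith), abs_sub_comm, abs_of_nonneg (by linarith)]
    refine le_min (by linarith [Real.exp_pos (-y / 2)]) ?_
    have h3 : Real.exp (-y / 2) = Real.exp (-x / 2) * Real.exp (-(y - x) / 2) := by
      rw [← Real.exp_add]; ring_nf
    have h4 := Real.add_one_le_exp (-(y - x) / 2)
    have h5 := Real.exp_pos (-x / 2)
    have h6 : Real.exp (-(y - x) / 2) ≤ 1 := Real.exp_le_one_iff.2 (by linarith)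
    rw [h3]
    nlinarith
  rcases le_total x y with h | h
  · exact key hx h
  · rw [abs_sub_comm, abs_sub_comm x]; exact key hy h

lemma TendstoInProbConst.tendsto_integral_exp (hX : TendstoInProbConst P X c)
    (hXm : ∀ N, AEMeasurable (X N) (P N)) (h : ∀ N, ∀ᵐ ω ∂(P N), 0 ≤ X N ω) :
    Tendsto (fun N => ∫ ω, Real.exp (-X N ω / 2) ∂(P N)) atTop (𝓝 (Real.exp (-c / 2))) := by
  have hc := hX.nonneg h
  rw [Metric.tendsto_atTop']
  intro ε hε
  have h1 : Tendsto (fun N => (P N).real {ω | ε / 2 ≤ |X N ω - c|}) atTop (𝓝 0) :=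
    (ENNReal.tendsto_toReal_zero_iff (fun N => measure_ne_top _ _)).2 (hX (ε / 2) (by positivity))
  have h2 := (h1.eventually_lt_const (by positivity : 0 < ε / 2))
  obtain ⟨N₀, hN₀⟩ := eventually_atTop.1 h2
  refine ⟨N₀, fun N hN => ?_⟩
  have hb := hN₀ N hN.le
  -- X_N is only almost everywhere measurable, so the deviation event is replaced by a measurable
  -- hull of the same measure.
  set T := toMeasurable (P N) {ω | ε / 2 ≤ |X N ω - c|} with hT
  have hTm : MeasurableSet T := measurableSet_toMeasurable _ _
  have hi : Integrable (fun ω => Real.exp (-X N ω / 2)) (P N) := by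
    refine (integrable_const (1 : ℝ)).mono'
      (by have := hXm N; exact (by fun_prop : AEMeasurable _ _).aestronglyMeasurable) ?_
    filter_upwards [h N] with ω hω
    rw [Real.norm_eq_abs, Real.abs_exp]
    exact Real.exp_le_one_iff.2 (by linarith)
  rw [Real.dist_eq]
  have e : ∫ ω, Real.exp (-X N ω / 2) ∂(P N) - Real.exp (-c / 2) =
      ∫ ω, (Real.exp (-X N ω / 2) - Real.exp (-c / 2)) ∂(P N) := by
    rw [integral_sub hi (integrable_const _)]; simp
  rw [e]
  have hle := norm_integral_le_of_norm_le
    (f := fun ω => Real.exp (-X N ω / 2) - Real.exp (-c / 2))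
    (((integrable_const (1 : ℝ)).indicator hTm).add (integrable_const (ε / 2))) (μ := P N) (by
      filter_upwards [h N] with ω hω
      have := abs_exp_neg_half_sub_le hω hc
      rw [Real.norm_eq_abs]
      refine this.trans ?_
      by_cases hω' : ω ∈ T
      · simp [hω']; left; linarith
      · have : ¬ ε / 2 ≤ |X N ω - c| := fun hcon => hω' (subset_toMeasurable _ _ hcon)
        simp [hω']; right; linarith)
  rw [Real.norm_eq_abs] at hle
  refine hle.trans_lt ?_
  have : ∫ a, (T.indicator (fun _ => (1 : ℝ)) a + ε / 2) ∂(P N) =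
      (P N).real {ω | ε / 2 ≤ |X N ω - c|} + ε / 2 := by
    rw [integral_add ((integrable_const (1 : ℝ)).indicator hTm) (integrable_const _),
      integral_indicator hTm]
    simp [Measure.real, hT]
  exact this.trans_lt (by linarith)

end InProb

/-- Folds the entries below the diagonal onto those above, as the limit has independent coordinates
only for s ≤ t. -/
lemma sum_prod_eq_sum_le {r : ℕ} {M : Type*} [AddCommMonoid M] (F : Fin r × Fin r → M) :
    ∑ x, F x = ∑ p : {p : Fin r × Fin r // p.1 ≤ p.2},
      if p.1.1 = p.1.2 then F p.1 else F p.1 + F p.1.swap := by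
  have h1 : ∑ x, F x = ∑ x : Fin r × Fin r, (if x.1 ≤ x.2 then F x else 0) +
      ∑ x : Fin r × Fin r, (if x.2 < x.1 then F x else 0) := by
    rw [← Finset.sum_add_distrib]
    refine Finset.sum_congr rfl fun x _ => ?_
    rcases le_or_gt x.1 x.2 with h | h
    · simp [h, not_lt.2 h]
    · simp [h, not_le.2 h]
  have h2 : ∑ x : Fin r × Fin r, (if x.2 < x.1 then F x else 0) =
      ∑ x : Fin r × Fin r, (if x.1 < x.2 then F x.swap else 0) :=
    (Equiv.sum_comp (Equiv.prodComm _ _) fun x : Fin r × Fin r =>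
      if x.2 < x.1 then F x else 0).symm
  rw [h1, h2, ← Finset.sum_add_distrib,
    ← Finset.sum_subtype (Finset.univ.filter fun p : Fin r × Fin r => p.1 ≤ p.2) (by simp)
      fun p => if p.1 = p.2 then F p else F p + F p.swap, Finset.sum_filter]
  refine Finset.sum_congr rfl fun x _ => ?_
  rcases lt_trichotomy x.1 x.2 with h | h | h
  · simp [h, h.le, h.ne]
  · simp [h]
  · simp [not_le.2 h, not_lt.2 h.le]

/-! ### Random coefficients independent of the variables -/

namespace IsStdFamily

variable {ι Ω : Type*} [Fintype ι] [DecidableEq ι] [MeasurableSpace Ω] {z : ι → Ω → ℝ}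
  {P : Measure Ω} {m : ℝ} [IsProbabilityMeasure P] {C : ℝ}

/-- The central limit estimate for a quadratic form whose coefficients are random and independent
of the variables. -/
theorem norm_integral_exp_centredQuad_random_sub_le (hz : IsStdFamily z P m) (hm : 1 ≤ m)
    (hC : 1 ≤ C) {A : Ω → ι → ι → ℝ} (hAm : Measurable A)
    (hind : IndepFun A (fun ω i => z i ω) P)
    (hs : ∀ᵐ ω ∂P, ∀ i j, A ω i j = A ω j i)
    (hA : ∀ᵐ ω ∂P, ∀ x : ι → ℝ, ∑ i, (∑ j, A ω i j * x j) ^ 2 ≤ C ^ 2 * ∑ i, x i ^ 2)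
    {s ε R : ℝ} (hs0 : 0 < s) (hε : 0 ≤ ε) (hR : 1 ≤ R) (hn : Fintype.card ι ≤ R * s ^ 2) :
    ‖(∫ ω, Complex.exp ((1 / s * centredQuad (A ω) (fun i => z i ω) : ℝ) * Complex.I) ∂P) -
      (∫ ω, Real.exp (-(1 / s ^ 2 * quadVar (fun k => ∫ ω, z k ω ^ 4 ∂P) (A ω)) / 2) ∂P : ℝ)‖ ≤
      512 * R * C ^ 4 * m ^ 2 * (1 / s) + 16 * R * C ^ 3 * m * ε + 8 * C ^ 2 * ((1 / s ^ 2) *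
        ∑ k, ∫ ω in {ω | ε * s < |(|z k ω| ^ 2 - 1)|}, |(|z k ω| ^ 2 - 1)| ^ 2 ∂P) := by
  set η := 512 * R * C ^ 4 * m ^ 2 * (1 / s) + 16 * R * C ^ 3 * m * ε + 8 * C ^ 2 * ((1 / s ^ 2) *
        ∑ k, ∫ ω in {ω | ε * s < |(|z k ω| ^ 2 - 1)|}, |(|z k ω| ^ 2 - 1)| ^ 2 ∂P)
  set μ₄ : ι → ℝ := fun k => ∫ ω, z k ω ^ 4 ∂P
  have hZm : Measurable (fun ω i => z i ω) := measurable_pi_lambda _ hz.meas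
  set F : (ι → ι → ℝ) × (ι → ℝ) → ℂ := fun p =>
    Complex.exp ((1 / s * centredQuad p.1 p.2 : ℝ) * Complex.I) with hF
  have hFm : Measurable F := by
    have : Measurable fun p : (ι → ι → ℝ) × (ι → ℝ) => centredQuad p.1 p.2 := by
      unfold centredQuad; fun_prop
    fun_prop
  have hFn : ∀ p, ‖F p‖ = 1 := fun p => Complex.norm_exp_ofReal_mul_I _
  have hmap := (indepFun_iff_map_prod_eq_prod_map_map hAm.aemeasurable hZm.aemeasurable).1 hind
  have := Measure.isProbabilityMeasure_map (μ := P) hAm.aemeasurable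
  have := Measure.isProbabilityMeasure_map (μ := P) hZm.aemeasurable
  have hFi : Integrable F ((P.map A).prod (P.map fun ω i => z i ω)) :=
    (integrable_const (1 : ℝ)).mono' hFm.aestronglyMeasurable (.of_forall fun p => (hFn p).le)
  set Φ : (ι → ι → ℝ) → ℂ := fun a => ∫ ω, F (a, fun i => z i ω) ∂P with hΦ
  have hΦ' : ∀ a, ∫ x, F (a, x) ∂(P.map fun ω i => z i ω) = Φ a := fun a =>
    integral_map hZm.aemeasurable (hFm.comp measurable_prodMk_left).aestronglyMeasurable
  have hΦi : Integrable Φ (P.map A) := by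
    have := hFi.integral_prod_left
    simpa only [hΦ'] using this
  -- The joint law is a product, so Fubini freezes the coefficients, and the deterministic estimate
  -- applies to almost every value of A.
  have e1 : ∫ ω, F (A ω, fun i => z i ω) ∂P = ∫ ω, Φ (A ω) ∂P := by
    rw [← integral_map (f := F) (φ := fun ω => (A ω, fun i => z i ω))
      (hAm.prodMk hZm).aemeasurable hFm.aestronglyMeasurable, hmap, integral_prod _ hFi]
    simp only [hΦ']
    exact integral_map hAm.aemeasurable hΦi.aestronglyMeasurable
  have hVm : Measurable fun ω => quadVar μ₄ (A ω) := by
    unfold quadVar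
    refine Finset.measurable_fun_sum _ fun k _ => ?_
    refine ((by fun_prop : Measurable fun ω => A ω k k ^ 2).mul_const _).add
      (Measurable.const_mul (Finset.measurable_fun_sum _ fun j _ => ?_) _)
    unfold offDiagPart
    split_ifs <;> fun_prop
  have hVi : Integrable (fun ω => Real.exp (-(1 / s ^ 2 * quadVar μ₄ (A ω)) / 2)) P := by
    refine (integrable_const (1 : ℝ)).mono' (Real.measurable_exp.comp
      ((hVm.const_mul _).neg.div_const 2)).aestronglyMeasurable (.of_forall fun ω => ?_)
    rw [Real.norm_eq_abs, Real.abs_exp]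
    have := mul_nonneg (by positivity : 0 ≤ 1 / s ^ 2) (hz.quadVar_nonneg (A := A ω))
    exact Real.exp_le_one_iff.2 (by linarith)
  have e2 : (∫ ω, F (A ω, fun i => z i ω) ∂P) -
      (∫ ω, Real.exp (-(1 / s ^ 2 * quadVar μ₄ (A ω)) / 2) ∂P : ℝ) =
      ∫ ω, (Φ (A ω) - (Real.exp (-(1 / s ^ 2 * quadVar μ₄ (A ω)) / 2) : ℝ)) ∂P := by
    have l := HasMean.sub (P := P) (f := fun ω => Φ (A ω)) ⟨hΦi.comp_measurable hAm, rfl⟩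
      ⟨hVi.ofReal (𝕜 := ℂ), rfl⟩
    rw [e1, ← integral_complex_ofReal]
    exact l.2.symm
  change ‖(∫ ω, F (A ω, fun i => z i ω) ∂P) - _‖ ≤ η
  rw [e2]
  have := norm_integral_le_of_norm_le (μ := P) (integrable_const η)
    (f := fun ω => Φ (A ω) - (Real.exp (-(1 / s ^ 2 * quadVar μ₄ (A ω)) / 2) : ℝ)) (by
      filter_upwards [hs, hA] with ω h1 h2
      exact hz.norm_integral_exp_centredQuad_sub_le hm hC h1 h2 hs0 hε hR hn)
  simpa using this

end IsStdFamily

/-! ### Reduction of the block family to one quadratic form -/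

/-- The square array obtained by gluing the blocks `c s t • b s t`. -/
def blockArray {r N : ℕ} (c : Fin r → Fin r → ℝ) (b : Fin r → Fin r → Matrix (Fin N) (Fin N) ℝ)
    (p q : Fin r × Fin N) : ℝ :=
  c p.1 q.1 * b p.1 q.1 p.2 q.2

section Block

variable {r N : ℕ} {c : Fin r → Fin r → ℝ} {b : Fin r → Fin r → Matrix (Fin N) (Fin N) ℝ}

lemma sum_mulVec_sq_le {B : Matrix (Fin N) (Fin N) ℝ} {a : ℝ}
    (h : ‖Matrix.toEuclideanCLM (𝕜 := ℝ) B‖ ≤ a) (x : Fin N → ℝ) :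
    ∑ i, (∑ j, B i j * x j) ^ 2 ≤ a ^ 2 * ∑ i, x i ^ 2 := by
  have h1 := (Matrix.toEuclideanCLM (𝕜 := ℝ) B).le_of_opNorm_le h (WithLp.toLp 2 x)
  have h2 := pow_le_pow_left₀ (norm_nonneg _) h1 2
  rw [mul_pow, EuclideanSpace.norm_sq_eq, EuclideanSpace.norm_sq_eq] at h2
  simpa [Matrix.mulVec, dotProduct] using h2

/-- Cauchy–Schwarz over the r blocks of a row costs one factor r, and summing over the r block rows
costs another. -/
lemma blockArray_bound {a K : ℝ} (hK : ∀ s t, |c s t| ≤ K)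
    (h : ∀ s t, ∀ x : Fin N → ℝ, ∑ i, (∑ j, b s t i j * x j) ^ 2 ≤ a ^ 2 * ∑ i, x i ^ 2)
    (x : Fin r × Fin N → ℝ) :
    ∑ p, (∑ q, blockArray c b p q * x q) ^ 2 ≤ (r * K * a) ^ 2 * ∑ p, x p ^ 2 := by
  have h1 : ∀ s, ∑ i, (∑ q, blockArray c b (s, i) q * x q) ^ 2 ≤
      r * (K ^ 2 * a ^ 2) * ∑ p, x p ^ 2 := fun s => by
    calc ∑ i, (∑ q, blockArray c b (s, i) q * x q) ^ 2
        = ∑ i, (∑ t, c s t * ∑ j, b s t i j * x (t, j)) ^ 2 := by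
          refine Finset.sum_congr rfl fun i _ => ?_
          rw [Fintype.sum_prod_type]
          simp only [blockArray, Finset.mul_sum, mul_assoc]
      _ ≤ ∑ i, r * ∑ t, K ^ 2 * (∑ j, b s t i j * x (t, j)) ^ 2 := by
          refine Finset.sum_le_sum fun i _ => ?_
          refine (sq_sum_le_card_mul_sum_sq).trans ?_
          rw [Finset.card_univ, Fintype.card_fin]
          gcongr with t
          rw [mul_pow, ← sq_abs (c s t)]
          gcongr
          exact hK s t
      _ = r * ∑ t, K ^ 2 * ∑ i, (∑ j, b s t i j * x (t, j)) ^ 2 := by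
          rw [← Finset.mul_sum, Finset.sum_comm]
          simp only [Finset.mul_sum]
      _ ≤ r * ∑ t, K ^ 2 * (a ^ 2 * ∑ j, x (t, j) ^ 2) := by
          gcongr with t
          exact h s t fun j => x (t, j)
      _ = r * (K ^ 2 * a ^ 2) * ∑ p, x p ^ 2 := by
          rw [Fintype.sum_prod_type]
          simp only [Finset.mul_sum, mul_assoc]
  rw [Fintype.sum_prod_type]
  calc _ ≤ ∑ _s : Fin r, r * (K ^ 2 * a ^ 2) * ∑ p, x p ^ 2 := Finset.sum_le_sum fun s _ => h1 s
    _ = _ := by rw [Finset.sum_const, Finset.card_univ, Fintype.card_fin, nsmul_eq_mul]; ring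

lemma blockArray_symm (hc : ∀ s t, c s t = c t s) (hb : ∀ s t, (b s t).transpose = b t s)
    (p q : Fin r × Fin N) : blockArray c b p q = blockArray c b q p := by
  unfold blockArray
  rw [hc p.1 q.1, ← hb q.1 p.1, Matrix.transpose_apply]

/-- Split μ₄ - 1 = (μ₄ - 3) + 2. The extra 2A_kk² completes the off-diagonal sum to the full
Hilbert–Schmidt norm, so the variance is expressed by the quantities of (iii) and (iv). -/
lemma quadVar_blockArray (μ₄ : Fin r × Fin N → ℝ) :
    quadVar μ₄ (blockArray c b) = ∑ s, c s s ^ 2 * ∑ i, b s s i i ^ 2 * (μ₄ (s, i) - 3) +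
      2 * ∑ s, ∑ t, c s t ^ 2 * ((b s t).transpose * b s t).trace := by
  have h1 : quadVar μ₄ (blockArray c b) = ∑ p, (blockArray c b p p ^ 2 * (μ₄ p - 3)) +
      2 * ∑ p, ∑ q, blockArray c b p q ^ 2 := by
    unfold quadVar
    rw [Finset.mul_sum, ← Finset.sum_add_distrib]
    refine Finset.sum_congr rfl fun p _ => ?_
    have : ∀ q, offDiagPart (blockArray c b) p q ^ 2 =
        blockArray c b p q ^ 2 - if p = q then blockArray c b p q ^ 2 else 0 := fun q => by
      unfold offDiagPart; split_ifs <;> simp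
    simp only [this, Finset.sum_sub_distrib, Finset.sum_ite_eq, Finset.mem_univ, if_true]
    ring
  rw [h1]
  congr 1
  · rw [Fintype.sum_prod_type]
    simp only [blockArray, Finset.mul_sum, mul_pow, mul_assoc]
  · congr 1
    simp only [Fintype.sum_prod_type, blockArray, Matrix.trace, Matrix.diag_apply, Matrix.mul_apply,
      Matrix.transpose_apply, Finset.mul_sum]
    refine Finset.sum_congr rfl fun s _ => ?_
    rw [Finset.sum_comm]
    refine Finset.sum_congr rfl fun t _ => ?_
    rw [Finset.sum_comm]
    exact Finset.sum_congr rfl fun i _ => Finset.sum_congr rfl fun j _ => by ring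

lemma sum_mul_quadFormMatrix {Ω : Type*} (y : Fin r → Fin N → Ω → ℝ)
    (B : Fin r → Fin r → Ω → Matrix (Fin N) (Fin N) ℝ) (ω : Ω) :
    ∑ s, ∑ t, c s t * quadFormMatrix y B ω s t =
      1 / √(N : ℝ) * centredQuad (blockArray c fun s t => B s t ω) fun p => y p.1 p.2 ω := by
  have h1 : ∑ p, blockArray c (fun s t => B s t ω) p p =
      ∑ s, ∑ t, c s t * (if s = t then (B s t ω).trace else 0) := by
    rw [Fintype.sum_prod_type]
    simp [blockArray, Matrix.trace, Finset.mul_sum]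
  have h2 : ∑ p, ∑ q, blockArray c (fun s t => B s t ω) p q * (y p.1 p.2 ω * y q.1 q.2 ω) =
      ∑ s, ∑ t, c s t * ((fun i => y s i ω) ⬝ᵥ (B s t ω).mulVec (fun i => y t i ω)) := by
    simp only [Fintype.sum_prod_type, blockArray, dotProduct, Matrix.mulVec, Finset.mul_sum]
    refine Finset.sum_congr rfl fun s _ => ?_
    rw [Finset.sum_comm]
    exact Finset.sum_congr rfl fun t _ => Finset.sum_congr rfl fun i _ =>
      Finset.sum_congr rfl fun j _ => by ring
  unfold centredQuad
  rw [h1, h2]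
  simp only [quadFormMatrix, ← Finset.sum_sub_distrib, Finset.mul_sum]
  exact Finset.sum_congr rfl fun s _ => Finset.sum_congr rfl fun t _ => by ring

lemma quadFormMatrix_symm {Ω : Type*} {y : Fin r → Fin N → Ω → ℝ}
    {B : Fin r → Fin r → Ω → Matrix (Fin N) (Fin N) ℝ} {ω : Ω}
    (h : ∀ s t, (B s t ω).transpose = B t s ω) (s t : Fin r) :
    quadFormMatrix y B ω s t = quadFormMatrix y B ω t s := by
  unfold quadFormMatrix
  congr 2
  · rw [← h s t, Matrix.mulVec_transpose, Matrix.dotProduct_mulVec, dotProduct_comm]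
  · by_cases hst : s = t
    · simp [hst]
    · simp [hst, Ne.symm hst]

/-- The estimate for quadratic forms needs a symmetric array, hence symmetric block coefficients. -/
lemma sum_mul_eq_sum_symm_mul (θ : Fin r → Fin r → ℝ) {q : Fin r → Fin r → ℝ}
    (hq : ∀ s t, q s t = q t s) :
    ∑ s, ∑ t, θ s t * q s t = ∑ s, ∑ t, ((θ s t + θ t s) / 2) * q s t := by
  have h : ∑ s, ∑ t, θ s t * q s t = ∑ s, ∑ t, θ t s * q s t := by
    rw [Finset.sum_comm]
    exact Finset.sum_congr rfl fun s _ => Finset.sum_congr rfl fun t _ => by rw [hq]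
  have h2 : ∑ s, ∑ t, ((θ s t + θ t s) / 2) * q s t =
      ((∑ s, ∑ t, θ s t * q s t) + ∑ s, ∑ t, θ t s * q s t) / 2 := by
    rw [← Finset.sum_add_distrib, Finset.sum_div]
    refine Finset.sum_congr rfl fun s _ => ?_
    rw [← Finset.sum_add_distrib, Finset.sum_div]
    exact Finset.sum_congr rfl fun t _ => by ring
  rw [h2, ← h]
  ring

lemma measurable_quadFormMatrix {Ω : Type*} [MeasurableSpace Ω] {y : Fin r → Fin N → Ω → ℝ}
    {B : Fin r → Fin r → Ω → Matrix (Fin N) (Fin N) ℝ} (hy : ∀ s j, Measurable (y s j))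
    (hB : ∀ s t i j, Measurable fun ω => B s t ω i j) : Measurable (quadFormMatrix y B) := by
  refine measurable_pi_lambda _ fun s => measurable_pi_lambda _ fun t => ?_
  unfold quadFormMatrix
  refine Measurable.const_mul (Measurable.sub ?_ ?_) _
  · simp only [dotProduct, Matrix.mulVec]
    fun_prop
  · split_ifs
    · simp only [Matrix.trace, Matrix.diag_apply]
      fun_prop
    · fun_prop

end Block

/-! ### The Gaussian limit -/

section Limit

variable {r : ℕ}

/-- The symmetric matrix whose upper triangular part is given by `x`. -/
def symmOfUpper (x : {p : Fin r × Fin r // p.1 ≤ p.2} → ℝ) (s t : Fin r) : ℝ :=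
  x ⟨(min s t, max s t), min_le_max⟩

lemma symmOfUpper_symm (x : {p : Fin r × Fin r // p.1 ≤ p.2} → ℝ) (s t : Fin r) :
    symmOfUpper x s t = symmOfUpper x t s := by
  simp only [symmOfUpper, min_comm s t, max_comm s t]

lemma symmOfUpper_apply (x : {p : Fin r × Fin r // p.1 ≤ p.2} → ℝ)
    (p : {p : Fin r × Fin r // p.1 ≤ p.2}) : symmOfUpper x p.1.1 p.1.2 = x p := by
  unfold symmOfUpper
  congr 1
  exact Subtype.ext (Prod.ext (min_eq_left p.2) (max_eq_right p.2))

lemma sum_mul_symmOfUpper (θ : Fin r → Fin r → ℝ) (x : {p : Fin r × Fin r // p.1 ≤ p.2} → ℝ) :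
    ∑ s, ∑ t, θ s t * symmOfUpper x s t =
      ∑ p : {p : Fin r × Fin r // p.1 ≤ p.2},
        ((if p.1.1 = p.1.2 then 1 else 2) * ((θ p.1.1 p.1.2 + θ p.1.2 p.1.1) / 2)) * x p := by
  rw [← Fintype.sum_prod_type (fun z : Fin r × Fin r => θ z.1 z.2 * symmOfUpper x z.1 z.2),
    sum_prod_eq_sum_le]
  refine Finset.sum_congr rfl fun p _ => ?_
  simp only [Prod.fst_swap, Prod.snd_swap, symmOfUpper_symm x p.1.2 p.1.1, symmOfUpper_apply]
  split_ifs with h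
  · rw [h]; ring
  · ring

/-- The characteristic function of a product of centred Gaussian measures. -/
lemma integral_exp_sum_pi_gaussianReal {κ : Type*} [Fintype κ] (v : κ → NNReal) (w : κ → ℝ) :
    ∫ x, Complex.exp ((∑ p, w p * x p : ℝ) * Complex.I) ∂(Measure.pi fun p => gaussianReal 0 (v p)) =
      Real.exp (-(∑ p, w p ^ 2 * v p) / 2) := by
  have h1 : ∀ x : κ → ℝ, Complex.exp ((∑ p, w p * x p : ℝ) * Complex.I) =
      ∏ p, Complex.exp (w p * x p * Complex.I) := fun x => by
    rw [← Complex.exp_sum]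
    push_cast
    rw [Finset.sum_mul]
  simp only [h1]
  rw [integral_fintype_prod_eq_prod (𝕜 := ℂ)
    (fun p (x : ℝ) => Complex.exp (w p * x * Complex.I))]
  have h2 : ∀ p, ∫ x : ℝ, Complex.exp (w p * x * Complex.I) ∂(gaussianReal 0 (v p)) =
      Complex.exp (-(w p ^ 2 * v p) / 2) := fun p => by
    rw [← charFun_apply_real, charFun_gaussianReal]
    congr 1
    push_cast
    ring
  simp only [h2]
  rw [← Complex.exp_sum]
  push_cast
  rw [← Finset.sum_div, Finset.sum_neg_distrib]

/-- An off-diagonal pair gives (2c)² a₂ = 4c² a₂, which is the doubled sum of its two mirror terms;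
a diagonal entry gives c²(a₁ + 2a₂). -/
lemma sum_sq_symm_variance (c : Fin r → Fin r → ℝ) (hc : ∀ s t, c s t = c t s) (a₁ : Fin r → ℝ)
    (a₂ : Fin r → Fin r → ℝ) (ha : ∀ s t, a₂ s t = a₂ t s) :
    ∑ p : {p : Fin r × Fin r // p.1 ≤ p.2}, ((if p.1.1 = p.1.2 then 1 else 2) * c p.1.1 p.1.2) ^ 2 *
      (if p.1.1 = p.1.2 then a₁ p.1.1 + 2 * a₂ p.1.1 p.1.1 else a₂ p.1.1 p.1.2) =
    ∑ s, c s s ^ 2 * a₁ s + 2 * ∑ s, ∑ t, c s t ^ 2 * a₂ s t := by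
  have h1 : ∑ s, c s s ^ 2 * a₁ s = ∑ s, ∑ t, if s = t then c s t ^ 2 * a₁ s else 0 := by
    simp
  rw [h1, Finset.mul_sum, ← Finset.sum_add_distrib]
  simp only [Finset.mul_sum, ← Finset.sum_add_distrib]
  rw [← Fintype.sum_prod_type (fun z : Fin r × Fin r =>
    (if z.1 = z.2 then c z.1 z.2 ^ 2 * a₁ z.1 else 0) + 2 * (c z.1 z.2 ^ 2 * a₂ z.1 z.2)),
    sum_prod_eq_sum_le]
  refine Finset.sum_congr rfl fun p _ => ?_
  simp only [Prod.fst_swap, Prod.snd_swap, hc p.1.2 p.1.1, ha p.1.2 p.1.1]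
  by_cases h : p.1.1 = p.1.2
  · simp [h]; ring
  · simp [h, Ne.symm h]; ring

end Limit

/-! ### Convergence of characteristic functions -/

section Convergence

variable {r : ℕ} {Ω : ℕ → Type*} [∀ N, MeasurableSpace (Ω N)]
    {P : ∀ N, Measure (Ω N)} [∀ N, IsProbabilityMeasure (P N)]
    {y : ∀ N, Fin r → Fin N → Ω N → ℝ}
    {B : ∀ N, Fin r → Fin r → Ω N → Matrix (Fin N) (Fin N) ℝ}
    {a₁ : Fin r → ℝ} {a₂ : Fin r → Fin r → ℝ} {m a : ℝ}

/-- The characteristic functions of the random matrices `quadFormMatrix` converge. -/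
theorem tendsto_integral_exp_quadFormMatrix
    (hz : ∀ N, IsStdFamily (fun p : Fin r × Fin N => y N p.1 p.2) (P N) m) (hm : 1 ≤ m)
    (hB_meas : ∀ N s t i j, Measurable (fun ω => B N s t ω i j))
    (hBy_indep : ∀ N, IndepFun
      (fun ω => ((fun s t i j => B N s t ω i j) : Fin r → Fin r → Fin N → Fin N → ℝ))
      (fun ω => ((fun s j => y N s j ω) : Fin r → Fin N → ℝ)) (P N))
    (hB_symm : ∀ N s t, ∀ᵐ ω ∂(P N), (B N s t ω).transpose = B N t s ω)
    (h_lind : ∀ s, ∀ ε : ℝ, 0 < ε →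
      Tendsto (fun N => lindebergSum (P N) (y N s) ε) atTop (𝓝 0))
    (hB_norm : ∀ N s t, ∀ᵐ ω ∂(P N), ‖Matrix.toEuclideanCLM (𝕜 := ℝ) (B N s t ω)‖ ≤ a)
    (h_a₂ : ∀ s t, TendstoInProbConst P
      (fun N ω => (1 / (N : ℝ)) * ((B N s t ω).transpose * B N s t ω).trace) (a₂ s t))
    (h_a₁ : ∀ s, TendstoInProbConst P
      (fun N ω => (1 / (N : ℝ)) * ∑ i, (B N s s ω i i) ^ 2 * kappa4 (P N) (y N s i)) (a₁ s))
    (θ : Fin r → Fin r → ℝ) :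
    Tendsto (fun N => ∫ ω, Complex.exp ((∑ s, ∑ t, θ s t * quadFormMatrix (y N) (B N) ω s t : ℝ) *
      Complex.I) ∂(P N)) atTop (𝓝 ((Real.exp (-(∑ s, ((θ s s + θ s s) / 2) ^ 2 * a₁ s +
        2 * ∑ s, ∑ t, ((θ s t + θ t s) / 2) ^ 2 * a₂ s t) / 2) : ℝ) : ℂ)) := by
  set c : Fin r → Fin r → ℝ := fun s t => (θ s t + θ t s) / 2 with hc
  have hcs : ∀ s t, c s t = c t s := fun s t => by simp only [hc, add_comm]
  set v := ∑ s, c s s ^ 2 * a₁ s + 2 * ∑ s, ∑ t, c s t ^ 2 * a₂ s t with hv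
  set K := ∑ s, ∑ t, |c s t| with hK
  have hK0 : 0 ≤ K := Finset.sum_nonneg fun s _ => Finset.sum_nonneg fun t _ => abs_nonneg _
  have hKc : ∀ s t, |c s t| ≤ K := fun s t =>
    (Finset.single_le_sum (f := fun t => |c s t|) (fun t _ => abs_nonneg _)
      (Finset.mem_univ t)).trans (Finset.single_le_sum (f := fun s => ∑ t, |c s t|)
      (fun s _ => Finset.sum_nonneg fun t _ => abs_nonneg _) (Finset.mem_univ s))
  set C := r * K * |a| + 1 with hCdef
  have hra : 0 ≤ r * K * |a| := by positivity
  have hC : 1 ≤ C := by linarith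
  -- There are rN variables; adding 1 keeps 1 ≤ R when r = 0.
  set R : ℝ := r + 1 with hRdef
  have hR : 1 ≤ R := by simp [hRdef]
  set A : ∀ N, Ω N → Fin r × Fin N → Fin r × Fin N → ℝ := fun N ω =>
    blockArray c fun s t => B N s t ω with hA
  set μ₄ : ∀ N, Fin r × Fin N → ℝ := fun N p => ∫ ω, y N p.1 p.2 ω ^ 4 ∂(P N) with hμ
  have hsymm : ∀ N, ∀ᵐ ω ∂(P N), ∀ s t, (B N s t ω).transpose = B N t s ω := fun N =>
    ae_all_iff.2 fun s => ae_all_iff.2 fun t => hB_symm N s t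
  have hnorm : ∀ N, ∀ᵐ ω ∂(P N), ∀ s t, ‖Matrix.toEuclideanCLM (𝕜 := ℝ) (B N s t ω)‖ ≤ a :=
    fun N => ae_all_iff.2 fun s => ae_all_iff.2 fun t => hB_norm N s t
  have hAm : ∀ N, Measurable (A N) := fun N =>
    measurable_pi_lambda _ fun p => measurable_pi_lambda _ fun q =>
      (hB_meas N p.1 q.1 p.2 q.2).const_mul _
  have hVm : ∀ N, Measurable fun ω => quadVar (μ₄ N) (A N ω) := fun N => by
    simp only [hA, quadVar_blockArray, Matrix.trace, Matrix.diag_apply, Matrix.mul_apply,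
      Matrix.transpose_apply]
    fun_prop
  -- convergence of the variances
  have hV : TendstoInProbConst P (fun N ω => 1 / √(N : ℝ) ^ 2 * quadVar (μ₄ N) (A N ω)) v := by
    have := (TendstoInProbConst.sum Finset.univ fun s _ => (h_a₁ s).const_mul (c s s ^ 2)).add
      ((TendstoInProbConst.sum Finset.univ fun s _ => TendstoInProbConst.sum Finset.univ
        fun t _ => (h_a₂ s t).const_mul (c s t ^ 2)).const_mul 2)
    refine this.congr fun N => .of_forall fun ω => ?_
    have hk : ∀ s i, kappa4 (P N) (y N s i) = μ₄ N (s, i) - 3 := fun s i => by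
      simp only [kappa4, hμ, (by decide : Even 4).pow_abs]
    rw [Real.sq_sqrt (Nat.cast_nonneg N)]
    simp only [hA, quadVar_blockArray, hk, Finset.mul_sum, mul_add]
    congr 1
    · exact Finset.sum_congr rfl fun s _ => Finset.sum_congr rfl fun i _ => by ring
    · exact Finset.sum_congr rfl fun s _ => Finset.sum_congr rfl fun t _ => by ring
  have hlim := hV.tendsto_integral_exp
    (fun N => ((hVm N).const_mul _).aemeasurable)
    (fun N => .of_forall fun ω => mul_nonneg (by positivity) (hz N).quadVar_nonneg)
  -- the quantitative bound
  set η : ℝ → ℕ → ℝ := fun ε N => 512 * R * C ^ 4 * m ^ 2 * (1 / √(N : ℝ)) +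
    16 * R * C ^ 3 * m * ε + 8 * C ^ 2 * ∑ s, lindebergSum (P N) (y N s) ε with hη
  have hbound : ∀ ε > 0, ∀ᶠ N : ℕ in atTop,
      ‖(∫ ω, Complex.exp ((∑ s, ∑ t, θ s t * quadFormMatrix (y N) (B N) ω s t : ℝ) *
        Complex.I) ∂(P N)) - (∫ ω, Real.exp (-(1 / √(N : ℝ) ^ 2 * quadVar (μ₄ N) (A N ω)) / 2)
          ∂(P N) : ℝ)‖ ≤ η ε N := by
    intro ε hε
    filter_upwards [eventually_gt_atTop 0] with N hN
    have hN' : (0 : ℝ) < N := by exact_mod_cast hN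
    have hind : IndepFun (A N) (fun ω (p : Fin r × Fin N) => y N p.1 p.2 ω) (P N) := by
      have := (hBy_indep N).comp
        (φ := fun (b : Fin r → Fin r → Fin N → Fin N → ℝ) (p q : Fin r × Fin N) =>
          c p.1 q.1 * b p.1 q.1 p.2 q.2)
        (ψ := fun (u : Fin r → Fin N → ℝ) (p : Fin r × Fin N) => u p.1 p.2)
        (by fun_prop) (by fun_prop)
      exact this
    have hq : ∫ ω, Complex.exp ((∑ s, ∑ t, θ s t * quadFormMatrix (y N) (B N) ω s t : ℝ) *
        Complex.I) ∂(P N) = ∫ ω, Complex.exp ((1 / √(N : ℝ) *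
          centredQuad (A N ω) (fun p => y N p.1 p.2 ω) : ℝ) * Complex.I) ∂(P N) := by
      refine integral_congr_ae ?_
      filter_upwards [hsymm N] with ω hω
      rw [sum_mul_eq_sum_symm_mul θ (quadFormMatrix_symm hω), sum_mul_quadFormMatrix]
    have key := (hz N).norm_integral_exp_centredQuad_random_sub_le hm hC (hAm N) hind
      (by
        filter_upwards [hsymm N] with ω hω
        exact blockArray_symm hcs hω)
      (by
        filter_upwards [hnorm N] with ω hω x
        have hx : 0 ≤ ∑ p, x p ^ 2 := Finset.sum_nonneg fun p _ => sq_nonneg _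
        refine (blockArray_bound hKc (fun s t => sum_mulVec_sq_le
          ((hω s t).trans (le_abs_self a))) x).trans ?_
        gcongr
        linarith)
      (s := √(N : ℝ)) (ε := ε) (R := R) (by positivity) hε.le hR (by
        rw [Real.sq_sqrt hN'.le, Fintype.card_prod, Fintype.card_fin, Fintype.card_fin]
        push_cast
        gcongr
        simp [hRdef])
    rw [hq]
    refine key.trans (le_of_eq ?_)
    simp only [hη, lindebergSum, Fintype.sum_prod_type, Real.sq_sqrt hN'.le, Finset.mul_sum]
  have hηlim : ∀ ε > 0, Tendsto (η ε) atTop (𝓝 (16 * R * C ^ 3 * m * ε)) := fun ε hε => by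
    have h1 : Tendsto (fun N : ℕ => 1 / √(N : ℝ)) atTop (𝓝 0) :=
      (tendsto_const_nhds.div_atTop (Real.tendsto_sqrt_atTop.comp tendsto_natCast_atTop_atTop))
    have h2 : Tendsto (fun N => ∑ s, lindebergSum (P N) (y N s) ε) atTop (𝓝 (∑ _s : Fin r, 0)) :=
      tendsto_finsetSum _ fun s _ => h_lind s ε hε
    have := ((h1.const_mul (512 * R * C ^ 4 * m ^ 2)).add_const (16 * R * C ^ 3 * m * ε)).add
      (h2.const_mul (8 * C ^ 2))
    simpa only [mul_zero, zero_add, add_zero, Finset.sum_const_zero] using this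
  -- For fixed ε the error tends to a multiple of ε as N → ∞; choosing ε so that this limit is δ/2
  -- makes the error eventually less than δ.
  have hdiff : Tendsto (fun N => (∫ ω, Complex.exp ((∑ s, ∑ t, θ s t *
      quadFormMatrix (y N) (B N) ω s t : ℝ) * Complex.I) ∂(P N)) -
      (∫ ω, Real.exp (-(1 / √(N : ℝ) ^ 2 * quadVar (μ₄ N) (A N ω)) / 2) ∂(P N) : ℝ))
      atTop (𝓝 0) := by
    rw [tendsto_zero_iff_norm_tendsto_zero]
    rw [Metric.tendsto_nhds]
    intro δ hδ
    have hD : 0 < 16 * R * C ^ 3 * m := by positivity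
    have hε : 0 < δ / (2 * (16 * R * C ^ 3 * m)) := by positivity
    have hlt : 16 * R * C ^ 3 * m * (δ / (2 * (16 * R * C ^ 3 * m))) < δ := by
      have : 16 * R * C ^ 3 * m * (δ / (2 * (16 * R * C ^ 3 * m))) = δ / 2 := by field_simp
      linarith
    filter_upwards [hbound _ hε, (hηlim _ hε).eventually_lt_const hlt] with N h1 h2
    simpa using h1.trans_lt h2
  have := hdiff.add ((Complex.continuous_ofReal.tendsto _).comp hlim)
  simpa using this

end Convergence

/-! ### Convergence in distribution and the main theorem -/

lemma charFun_map_toLp {κ Ω : Type*} [Fintype κ] [MeasurableSpace Ω] {P : Measure Ω}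
    {Y : Ω → κ → ℝ} (hY : Measurable Y) (t : EuclideanSpace ℝ κ) :
    charFun (P.map fun ω => (WithLp.toLp 2 (Y ω) : EuclideanSpace ℝ κ)) t =
      ∫ ω, Complex.exp ((∑ k, t k * Y ω k : ℝ) * Complex.I) ∂P := by
  have hL : Measurable (WithLp.toLp 2 : (κ → ℝ) → EuclideanSpace ℝ κ) :=
    (PiLp.continuous_toLp 2 _).measurable
  rw [charFun_apply, integral_map (φ := fun ω => (WithLp.toLp 2 (Y ω) : EuclideanSpace ℝ κ))
    (hL.comp hY).aemeasurable (by fun_prop : Continuous _).aestronglyMeasurable]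
  simp [PiLp.inner_apply]

/-- Lévy's theorem is applied in Euclidean space, where characteristic functions use the inner
product, and carried back by the continuous map to `κ → ℝ`. -/
lemma tendstoInDistribution_of_tendsto_integral_exp {κ : Type*} [Fintype κ]
    {Ω : ℕ → Type*} [∀ N, MeasurableSpace (Ω N)] {P : ∀ N, Measure (Ω N)}
    [∀ N, IsProbabilityMeasure (P N)] {Ω' : Type*} [MeasurableSpace Ω'] {P' : Measure Ω'}
    [IsProbabilityMeasure P'] {X : ∀ N, Ω N → κ → ℝ} {G : Ω' → κ → ℝ}
    (hX : ∀ N, Measurable (X N)) (hG : Measurable G)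
    (h : ∀ θ : κ → ℝ, Tendsto (fun N => ∫ ω, Complex.exp ((∑ k, θ k * X N ω k : ℝ) * Complex.I)
      ∂(P N)) atTop (𝓝 (∫ ω, Complex.exp ((∑ k, θ k * G ω k : ℝ) * Complex.I) ∂P'))) :
    TendstoInDistribution X atTop G P P' := by
  have hL : Measurable (WithLp.toLp 2 : (κ → ℝ) → EuclideanSpace ℝ κ) :=
    (PiLp.continuous_toLp 2 _).measurable
  have hE : TendstoInDistribution (fun N ω => (WithLp.toLp 2 (X N ω) : EuclideanSpace ℝ κ)) atTop
      (fun ω => WithLp.toLp 2 (G ω)) P P' := by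
    refine ⟨fun N => (hL.comp (hX N)).aemeasurable, (hL.comp hG).aemeasurable, ?_⟩
    refine ProbabilityMeasure.tendsto_iff_tendsto_charFun.2 fun t => ?_
    simp only [ProbabilityMeasure.coe_mk]
    have h1 := fun N => charFun_map_toLp (P := P N) (hX N) t
    rw [charFun_map_toLp hG t]
    simp only [h1]
    exact h t
  exact hE.continuous_comp (PiLp.continuous_ofLp 2 _)

theorem theoremA4 {r : ℕ} {Ω : ℕ → Type*} [∀ N, MeasurableSpace (Ω N)]
    (P : ∀ N, Measure (Ω N)) [∀ N, IsProbabilityMeasure (P N)]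
    (y : ∀ N, Fin r → Fin N → Ω N → ℝ)
    (B : ∀ N, Fin r → Fin r → Ω N → Matrix (Fin N) (Fin N) ℝ)
    (a₁ : Fin r → ℝ) (a₂ : Fin r → Fin r → ℝ) (m₄ a : ℝ)
    -- the entries are random variables
    (hy_meas : ∀ N s j, Measurable (y N s j))
    (hB_meas : ∀ N s t i j, Measurable (fun ω => B N s t ω i j))
    -- the entries of all the vectors are jointly independent and standardized
    (hy_indep : ∀ N, iIndepFun (fun p : Fin r × Fin N => y N p.1 p.2) (P N))
    (hy_mean : ∀ N s j, ∫ ω, y N s j ω ∂(P N) = 0)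
    (hy_var : ∀ N s j, variance (y N s j) (P N) = 1)
    -- with uniformly bounded fourth moments
    (hy_memLp : ∀ N s j, MemLp (y N s j) 4 (P N))
    (hy_four : ∀ N s j, ∫ ω, |y N s j ω| ^ 4 ∂(P N) ≤ m₄)
    -- the family of matrices is independent of the family of vectors
    (hBy_indep : ∀ N, IndepFun
      (fun ω => ((fun s t i j => B N s t ω i j) : Fin r → Fin r → Fin N → Fin N → ℝ))
      (fun ω => ((fun s j => y N s j ω) : Fin r → Fin N → ℝ)) (P N))
    (hB_symm : ∀ N s t, ∀ᵐ ω ∂(P N), (B N s t ω).transpose = B N t s ω)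
    -- (i) Lindeberg condition
    (h_lind : ∀ s, ∀ ε : ℝ, 0 < ε →
      Tendsto (fun N => lindebergSum (P N) (y N s) ε) atTop (𝓝 0))
    -- (ii) bound on the operator norms
    (hB_norm : ∀ N s t, ∀ᵐ ω ∂(P N), ‖Matrix.toEuclideanCLM (𝕜 := ℝ) (B N s t ω)‖ ≤ a)
    -- (iii), (iv) convergence in probability of normalized traces
    (h_a₂ : ∀ s t, TendstoInProbConst P
      (fun N ω => (1 / (N : ℝ)) * ((B N s t ω).transpose * B N s t ω).trace) (a₂ s t))
    (h_a₁ : ∀ s, TendstoInProbConst P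
      (fun N ω => (1 / (N : ℝ)) * ∑ i, (B N s s ω i i) ^ 2 * kappa4 (P N) (y N s i)) (a₁ s)) :
    -- the limiting variances are non-negative
    (∀ s t, s ≠ t → 0 ≤ a₂ s t) ∧ (∀ s, 0 ≤ a₁ s + 2 * a₂ s s) ∧
    ∃ (Ω' : Type) (_ : MeasurableSpace Ω') (P' : Measure Ω') (_ : IsProbabilityMeasure P')
      (G : Ω' → Fin r → Fin r → ℝ),
      (∀ ω s t, G ω s t = G ω t s) ∧
      iIndepFun (fun (p : {p : Fin r × Fin r // p.1 ≤ p.2}) ω => G ω p.1.1 p.1.2) P' ∧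
      (∀ s t, s ≠ t →
        HasLaw (fun ω => G ω s t) (gaussianReal 0 (a₂ s t).toNNReal) P') ∧
      (∀ s, HasLaw (fun ω => G ω s s) (gaussianReal 0 (a₁ s + 2 * a₂ s s).toNNReal) P') ∧
      TendstoInDistribution (fun N => quadFormMatrix (y N) (B N)) atTop G P P' := by
  -- Taking the maximum with 1 covers r = 0, where nothing forces 1 ≤ m₄.
  have hz : ∀ N, IsStdFamily (fun p : Fin r × Fin N => y N p.1 p.2) (P N) (max m₄ 1) := fun N =>
    { meas := fun p => hy_meas N p.1 p.2
      indep := hy_indep N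
      mean := fun p => hy_mean N p.1 p.2
      sq := fun p => by
        rw [← hy_var N p.1 p.2, variance_of_integral_eq_zero (hy_meas N p.1 p.2).aemeasurable
          (hy_mean N p.1 p.2)]
      memLp := fun p => hy_memLp N p.1 p.2
      four := fun p => by
        have := hy_four N p.1 p.2
        simp only [(by decide : Even 4).pow_abs] at this
        exact this.trans (le_max_left _ _) }
  have htr : ∀ N s t (ω : Ω N), ((B N s t ω).transpose * B N s t ω).trace =
      ∑ i, ∑ j, B N s t ω j i ^ 2 := fun N s t ω => by
    simp only [Matrix.trace, Matrix.diag_apply, Matrix.mul_apply, Matrix.transpose_apply, pow_two]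
  have ha₂ : ∀ s t, 0 ≤ a₂ s t := fun s t => (h_a₂ s t).nonneg fun N => .of_forall fun ω => by
    rw [htr]
    positivity
  -- Both are limits of the same quantity, because tr BᵀB = tr BBᵀ.
  have ha₂s : ∀ s t, a₂ s t = a₂ t s := fun s t => by
    refine (h_a₂ s t).unique ((h_a₂ t s).congr fun N => ?_)
    filter_upwards [hB_symm N s t] with ω hω
    rw [← hω, Matrix.transpose_transpose, Matrix.trace_mul_comm]
  -- E y⁴ ≥ 1 bounds the cumulant below by -2, and ∑ B_ii² ≤ tr BᵀB compensates; the sign passes to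
  -- the limit in probability.
  have ha₁ : ∀ s, 0 ≤ a₁ s + 2 * a₂ s s := fun s => by
    refine ((h_a₁ s).add ((h_a₂ s s).const_mul 2)).nonneg fun N => .of_forall fun ω => ?_
    have h1 : ∑ i, B N s s ω i i ^ 2 ≤ ((B N s s ω).transpose * B N s s ω).trace := by
      rw [htr]
      exact Finset.sum_le_sum fun i _ => Finset.single_le_sum (f := fun j => B N s s ω j i ^ 2)
        (fun j _ => sq_nonneg _) (Finset.mem_univ i)
    have h2 : -2 * ∑ i, B N s s ω i i ^ 2 ≤ ∑ i, B N s s ω i i ^ 2 * kappa4 (P N) (y N s i) := by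
      rw [Finset.mul_sum]
      refine Finset.sum_le_sum fun i _ => ?_
      have : -2 ≤ kappa4 (P N) (y N s i) := by
        have := (hz N).one_le_four (s, i)
        simp only [kappa4, (by decide : Even 4).pow_abs]
        linarith
      nlinarith [sq_nonneg (B N s s ω i i)]
    have h3 : 0 ≤ (1 / (N : ℝ)) * (∑ i, B N s s ω i i ^ 2 * kappa4 (P N) (y N s i) +
        2 * ((B N s s ω).transpose * B N s s ω).trace) :=
      mul_nonneg (by positivity) (by linarith)
    linarith
  refine ⟨fun s t _ => ha₂ s t, ha₁, ?_⟩
  set v : {p : Fin r × Fin r // p.1 ≤ p.2} → ℝ := fun p =>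
    if p.1.1 = p.1.2 then a₁ p.1.1 + 2 * a₂ p.1.1 p.1.1 else a₂ p.1.1 p.1.2 with hv
  have hv0 : ∀ p, 0 ≤ v p := fun p => by
    simp only [hv]; split_ifs; exacts [ha₁ _, ha₂ _ _]
  set μ : Measure ({p : Fin r × Fin r // p.1 ≤ p.2} → ℝ) :=
    Measure.pi fun p => gaussianReal 0 (v p).toNNReal with hμ
  have heval : ∀ p, HasLaw (fun x : {p : Fin r × Fin r // p.1 ≤ p.2} → ℝ => x p)
      (gaussianReal 0 (v p).toNNReal) μ := fun p =>
    (measurePreserving_eval (fun p => gaussianReal 0 (v p).toNNReal) p).hasLaw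
  have hGm : Measurable (symmOfUpper (r := r)) :=
    measurable_pi_lambda _ fun s => measurable_pi_lambda _ fun t => measurable_pi_apply _
  refine ⟨_, inferInstance, μ, inferInstance, symmOfUpper, symmOfUpper_symm, ?_, fun s t hst => ?_,
    fun s => ?_, ?_⟩
  · simp only [symmOfUpper_apply]
    exact iIndepFun_pi (X := fun _ x => x) fun _ => aemeasurable_id
  · have := heval ⟨(min s t, max s t), min_le_max⟩
    rcases lt_or_gt_of_ne hst with h | h
    · simpa [hv, h.le, hst, symmOfUpper] using this
    · simpa [hv, h.le, hst.symm, symmOfUpper, ha₂s t s] using this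
  · simpa [hv, symmOfUpper] using heval ⟨(min s s, max s s), min_le_max⟩
  · have hu : TendstoInDistribution (fun N ω (k : Fin r × Fin r) =>
        quadFormMatrix (y N) (B N) ω k.1 k.2) atTop (fun ω k => symmOfUpper ω k.1 k.2) P μ := by
      refine tendstoInDistribution_of_tendsto_integral_exp (fun N => ?_) ?_ fun θ => ?_
      · have := measurable_quadFormMatrix (hy_meas N) (hB_meas N)
        fun_prop
      · fun_prop
      · have := tendsto_integral_exp_quadFormMatrix hz (le_max_right _ _) hB_meas hBy_indep hB_symm
          h_lind hB_norm h_a₂ h_a₁ (fun s t => θ (s, t))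
        simp only [Fintype.sum_prod_type]
        convert this using 2
        simp only [sum_mul_symmOfUpper (fun s t => θ (s, t))]
        rw [hμ, integral_exp_sum_pi_gaussianReal,
          ← sum_sq_symm_variance (fun s t => (θ (s, t) + θ (t, s)) / 2)
            (fun s t => by simp only [add_comm]) a₁ a₂ ha₂s]
        simp only [fun p => Real.coe_toNNReal _ (hv0 p)]
        simp only [hv]
    exact hu.continuous_comp (g := fun (x : Fin r × Fin r → ℝ) s t => x (s, t)) (by fun_prop)
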